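/- **Setting.** Let $d\ge 1$, let $P_X$ be a probability distribution on $\mathbb{R}^d$ whose support is not contained in any hyperplane through the origin (i.e. $\mathbb{P}(\langle w,X\rangle=0)<1$ for every $w\neq 0$), let $\sigma^2\in(0,\infty)$ and $\delta\in(0,1)$. Let $e:\mathbb{R}\to\mathbb{R}$ be strictly convex, symmetric ($e(-t)=e(t)$ for all $t$) and twice differentiable. Let $\mathcal{P}_{\mathrm{Gauss}}(P_X,\sigma^2)$ be the set of laws of $(X,Y)$ with $Y=\langle w^*,X\rangle+\eta$, where $(X,\eta)\sim P_X\times\mathcal{N}(0,\sigma^2)$ and $w^*$ ranges over $\mathbb{R}^d$. For $P$ in this class and $(X,Y)\sim P$, put $E_P(w)=\mathbb{E}[e(\langle w,X\rangle-Y)]$ and $\mathcal{E}_P(w)=E_P(w)-\inf_{v\in\mathbb{R}^d}E_P(v)$. For a measurable procedure $\hat w:(\mathbb{R}^d\times\mathbb{R})^n\to\mathbb{R}^d$ applied to an i.i.d. sample $(X_i,Y_i)_{i=1}^n$ from $P$, the quantile risk is $$R_{n,\delta}(P,\hat w)=\inf\{t\ge 0 : \mathbb{P}(\mathcal{E}_P(\hat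 w((X_i,Y_i)_{i=1}^n))\le t)\ge 1-\delta\}\in[0,\infty],$$ and the minimax quantile risk is $$R^*_{n,\delta}(\mathcal{P}_{\mathrm{Gauss}}(P_X,\sigma^2))=\inf_{\hat w}\ \sup_{P\in\mathcal{P}_{\mathrm{Gauss}}(P_X,\sigma^2)}R_{n,\delta}(P,\hat w),$$ the infimum being over all measurable procedures. For a nonnegative random variable $V$ write $Q_V(p)=\inf\{t\ge 0:\mathbb{P}(V\le t)\ge p\}$. For $(X,\eta)\sim P_X\times\mathcal{N}(0,\sigma^2)$ let $\widetilde E(\Delta)=\mathbb{E}[e(\langle\Delta,X\rangle+\eta)]$. Assume that $\widetilde E$ is finite everywhere; that it is differentiable at $0$ with $\nabla\widetilde E(0)=\mathbb{E}[e'(\eta)X]$; and that it is twice differentiable at $0$ with $\nabla^2\widetilde E(0)=\mathbb{E}[e''(\eta)XX^{T}]$ (these expectations being assumed to exist). Let $\alpha=\mathbb{E}[e''(\eta)]/2$. **Proposition.** With $Z\sim\mathcal{N}(0,I_{d\times d})$, $$\lim_{n\to\infty} n\cdot R^*_{n,\delta}(\mathcal{P}_{\mathrm{Gauss}}(P_X,\sigma^2))=\sigma^2\alpha\cdot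 Q_{\|Z\|_2^2}(1-\delta).$$ Moreover, there are absolute constants $c,C>0$ (independent of $d,P_X,\sigma,e,\delta$) such that, whenever $\delta\in(0,1/2)$, $$c\,\sigma^2\alpha\,[d+\log(1/\delta)]\ \le\ \sigma^2\alpha\cdot Q_{\|Z\|_2^2}(1-\delta)\ \le\ C\,\sigma^2\alpha\,[d+\log(1/\delta)].$$ -/

import Mathlib

open MeasureTheory ProbabilityTheory Filter Topology
open scoped ENNReal NNReal

noncomputable section

namespace QuantileRegression

/-- Input vectors and weight vectors: `ℝ^d` with the Euclidean norm. -/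
abbrev Vec (d : ℕ) : Type := EuclideanSpace ℝ (Fin d)

/-- The quantile of order `p` of a nonnegative random variable `f` on `(Ω, μ)`:
`inf {t ≥ 0 | μ (f ≤ t) ≥ p}`, an element of `[0, ∞]` (the infimum of the empty set is `∞`). -/
def quantile {Ω : Type*} [MeasurableSpace Ω] (μ : Measure Ω) (f : Ω → ℝ) (p : ℝ) : ℝ≥0∞ :=
  ⨅ (t : ℝ≥0) (_ : ENNReal.ofReal p ≤ μ {ω | f ω ≤ (t : ℝ)}), (t : ℝ≥0∞)

/-- The expected error `E(w) = 𝔼[e(⟨w, X⟩ - Y)]` for `(X, Y) ∼ P`. -/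
def expectedError {d : ℕ} (e : ℝ → ℝ) (P : Measure (Vec d × ℝ)) (w : Vec d) : ℝ :=
  ∫ z, e (inner ℝ w z.1 - z.2) ∂P

/-- The excess expected error `ℰ(w) = E(w) - inf_v E(v)`. -/
def excessError {d : ℕ} (e : ℝ → ℝ) (P : Measure (Vec d × ℝ)) (w : Vec d) : ℝ :=
  expectedError e P w - ⨅ v : Vec d, expectedError e P v

/-- The quantile risk `R_{n,δ}(P, ŵ)`: the `1 - δ` quantile of `ℰ(ŵ((X_i, Y_i)_{i ≤ n}))`
for an i.i.d. sample `(X_i, Y_i)_{i ≤ n}` from `P`. -/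
def quantileRisk {d : ℕ} (e : ℝ → ℝ) (n : ℕ) (δ : ℝ) (P : Measure (Vec d × ℝ))
    (what : (Fin n → Vec d × ℝ) → Vec d) : ℝ≥0∞ :=
  quantile (Measure.pi fun _ : Fin n => P) (fun D => excessError e P (what D)) (1 - δ)

/-- The minimax quantile risk `R*_{n,δ}(cls)`: the infimum over all (measurable) procedures `ŵ` of
the worst-case quantile risk of `ŵ` over the class `cls`. -/
def minimaxRisk {d : ℕ} (e : ℝ → ℝ) (n : ℕ) (δ : ℝ) (cls : Set (Measure (Vec d × ℝ))) : ℝ≥0∞ :=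
  ⨅ (what : (Fin n → Vec d × ℝ) → Vec d) (_ : Measurable what),
    ⨆ P ∈ cls, quantileRisk e n δ P what

/-- The joint law `P_X × N(0, σ²)` of the input `X` and the independent noise `η`. -/
def inputNoise {d : ℕ} (PX : Measure (Vec d)) (σ : ℝ≥0) : Measure (Vec d × ℝ) :=
  PX.prod (gaussianReal 0 (σ ^ 2))

/-- The class `𝒫_Gauss(P_X, σ²)`: the laws of `(X, Y)` with `Y = ⟨w*, X⟩ + η` for some `w*`,
where `(X, η) ∼ P_X × N(0, σ²)`. -/
def gaussClass {d : ℕ} (PX : Measure (Vec d)) (σ : ℝ≥0) : Set (Measure (Vec d × ℝ)) :=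
  {P | ∃ wstar : Vec d,
    P = (inputNoise PX σ).map fun z => (z.1, inner ℝ wstar z.1 + z.2)}

/-- `Ẽ(Δ) = 𝔼[e(⟨Δ, X⟩ + η)]` for `(X, η) ∼ P_X × N(0, σ²)`. -/
def Etilde {d : ℕ} (e : ℝ → ℝ) (PX : Measure (Vec d)) (σ : ℝ≥0) (Δ : Vec d) : ℝ :=
  ∫ z, e (inner ℝ Δ z.1 + z.2) ∂(inputNoise PX σ)

/-- `Ẽ` is differentiable at `0` with gradient `𝔼[e'(η) X]`, the expectation of the gradient at
`Δ = 0` of `Δ ↦ e(⟨Δ, X⟩ + η)` (in particular this expectation exists). -/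
def GradientAtZero {d : ℕ} (e : ℝ → ℝ) (PX : Measure (Vec d)) (σ : ℝ≥0) : Prop :=
  Integrable (fun z : Vec d × ℝ => deriv e z.2 • z.1) (inputNoise PX σ) ∧
  HasGradientAt (Etilde e PX σ) (∫ z, deriv e z.2 • z.1 ∂(inputNoise PX σ)) 0

/-- `Ẽ` is twice differentiable at `0` (differentiable near `0`, with gradient differentiable
at `0`) with Hessian `𝔼[e''(η) X Xᵀ]`, the expectation of the Hessian at `Δ = 0` of
`Δ ↦ e(⟨Δ, X⟩ + η)` (in particular this expectation exists). The operator
`InnerProductSpace.rankOne ℝ x x` is `v ↦ ⟨x, v⟩ x`, whose matrix is `x xᵀ`. -/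
def HessianAtZero {d : ℕ} (e : ℝ → ℝ) (PX : Measure (Vec d)) (σ : ℝ≥0) : Prop :=
  (∀ᶠ Δ in 𝓝 (0 : Vec d), DifferentiableAt ℝ (Etilde e PX σ) Δ) ∧
  Integrable (fun z : Vec d × ℝ => deriv (deriv e) z.2 • InnerProductSpace.rankOne ℝ z.1 z.1)
    (inputNoise PX σ) ∧
  HasFDerivAt (gradient (Etilde e PX σ))
    (∫ z, deriv (deriv e) z.2 • InnerProductSpace.rankOne ℝ z.1 z.1 ∂(inputNoise PX σ)) 0

end QuantileRegression

end

/-! Since the loss is even and the noise symmetric, the excess error of `ŵ` is `g (ŵ - w*)` for the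
convex function g = Ẽ - Ẽ(0), which has its minimum at 0 and Hessian 2αS there, with S = 𝔼[XXᵀ].
Convexity turns this local expansion into a comparison of the low sublevel sets of g with ellipsoids
of S (`exists_le_quadratic`, `exists_quadratic_le`), so at scale 1/n the problem is to estimate w*
under the loss α⟨Sv, v⟩. By the law of large numbers the Gram operator of the sample is within a
factor 1 ± ε of nS, outside a set of designs of vanishing probability. What remains is a Gaussian
linear model with fixed design, and there both bounds are exact.

Upper bound: the in-sample squared error of least squares is σ² times a χ² variable with d degrees
of freedom (`leastSquares_inSample_error`).

Lower bound: put the prior N(0, σ²I) on w*. For a fixed design, the whitened deviation of the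
parameter from its posterior mean is standard Gaussian and independent of the responses. Any
estimator therefore amounts to a choice of centre for a ball of fixed radius, and the centred ball
has the largest Gaussian mass (`prior_mass_le`). The prior contributes ‖v‖² to the posterior form,
which is negligible against n⟨Sv, v⟩; hence one fixed prior suffices and no flat limit is needed.

The losses in ε and the bad designs are absorbed by working strictly below or above the limit, using
that the χ² distribution function is strictly increasing. The two-sided estimate of the χ² quantile
comes from exponential moments and, for the logarithmic term, from the tail of a single coordinate.
-/

namespace QuantileRegression

/-! ### Whitening, and the posterior in the Gaussian linear model. -/

section Gaussian

variable {E F : Type*} [NormedAddCommGroup E] [InnerProductSpace ℝ E] [FiniteDimensional ℝ E]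

/-- A symmetric positive definite operator becomes the identity after a linear change of
variables. -/
lemma exists_whitening (M : E →L[ℝ] E) (hsym : ∀ u v, inner ℝ (M u) v = inner ℝ u (M v))
    (hpos : ∀ v, v ≠ 0 → 0 < inner ℝ (M v) v) :
    ∃ B : E ≃L[ℝ] E, ∀ u v, inner ℝ (M (B u)) (B v) = inner ℝ u v := by
  have hS : (M : E →ₗ[ℝ] E).IsSymmetric := fun u v => hsym u v
  let b := hS.eigenvectorBasis rfl
  let μ := hS.eigenvalues rfl
  have hMb : ∀ i, M (b i) = μ i • b i := fun i => hS.apply_eigenvectorBasis rfl i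
  have hμ : ∀ i, 0 < μ i := by
    intro i
    have h := hpos (b i) (b.orthonormal.ne_zero i)
    rw [hMb, inner_smul_left, real_inner_self_eq_norm_sq, b.orthonormal.1 i] at h
    simpa using h
  -- Dividing each eigenvector by the square root of its eigenvalue gives a basis that is
  -- orthonormal for the form of `M`; `B` carries the eigenbasis to it.
  let c : Fin (Module.finrank ℝ E) → ℝˣ := fun i =>
    Units.mk0 (√(μ i))⁻¹ (inv_ne_zero (Real.sqrt_pos.2 (hμ i)).ne')
  let b' : Module.Basis _ ℝ E := b.toBasis.unitsSMul c
  have hb' : ∀ i, b' i = (√(μ i))⁻¹ • b i := fun i => by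
    simp [b', c, Module.Basis.unitsSMul_apply, Units.smul_def]
  let B : E ≃ₗ[ℝ] E := b.toBasis.equiv b' (Equiv.refl _)
  have hB : ∀ i, B (b i) = b' i := fun i => by
    simpa using b.toBasis.equiv_apply (b' := b') i (Equiv.refl _)
  refine ⟨B.toContinuousLinearEquiv, fun u v => ?_⟩
  have key : ∀ i j, inner ℝ (M (B (b i))) (B (b j)) = inner ℝ (b i) (b j) := by
    intro i j
    rw [hB, hB, hb', hb', map_smul, hMb, inner_smul_left, inner_smul_left, inner_smul_right]
    rcases eq_or_ne i j with rfl | hij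
    · rw [real_inner_self_eq_norm_sq, b.orthonormal.1 i]
      have := Real.mul_self_sqrt (hμ i).le
      have h0 := (Real.sqrt_pos.2 (hμ i)).ne'
      simp only [conj_trivial]
      field_simp
      nlinarith
    · rw [b.orthonormal.2 hij]; simp
  change inner ℝ (M (B u)) (B v) = inner ℝ u v
  rw [← b.sum_repr u, ← b.sum_repr v]
  simp only [map_sum, map_smul, sum_inner, inner_sum, inner_smul_left, inner_smul_right, key]

variable [MeasurableSpace E] [BorelSpace E]
  [NormedAddCommGroup F] [InnerProductSpace ℝ F] [FiniteDimensional ℝ F]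
  [MeasurableSpace F] [BorelSpace F]

/-- The image of a standard Gaussian vector under a coisometry is standard Gaussian. -/
lemma stdGaussian_map_of_norm_adjoint (L : F →L[ℝ] E)
    (hL : ∀ t, ‖ContinuousLinearMap.adjoint L t‖ = ‖t‖) :
    (stdGaussian F).map L = stdGaussian E := by
  have : IsProbabilityMeasure ((stdGaussian F).map L) :=
    Measure.isProbabilityMeasure_map (by fun_prop)
  refine Measure.ext_of_charFun (funext fun t => ?_)
  have : charFun ((stdGaussian F).map L) t
      = charFun (stdGaussian F) (ContinuousLinearMap.adjoint L t) := by
    rw [charFun_apply, charFun_apply, integral_map (by fun_prop) (by fun_prop)]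
    simp only [ContinuousLinearMap.adjoint_inner_right]
  rw [this, charFun_stdGaussian, charFun_stdGaussian, hL]

/-- In the Gaussian linear model `Y = A G + ε` with standard Gaussian prior, the whitened
residual `B† (G - A† ε)` is a standard Gaussian vector independent of `Y`. -/
lemma map_residual_observation (A : E →L[ℝ] F) (B : E →L[ℝ] E)
    (hB : ∀ u v, inner ℝ (B u) (B v) + inner ℝ (A (B u)) (A (B v)) = inner ℝ u v) :
    ((stdGaussian E).prod (stdGaussian F)).map (fun p : E × F =>
        (ContinuousLinearMap.adjoint B (p.1 - ContinuousLinearMap.adjoint A p.2), A p.1 + p.2)) =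
      (stdGaussian E).prod
        (((stdGaussian E).prod (stdGaussian F)).map (fun p : E × F => A p.1 + p.2)) := by
  have m1 : Measurable (fun p : E × F => A p.1 + p.2) := by fun_prop
  have m2 : Measurable (fun p : E × F =>
        (ContinuousLinearMap.adjoint B (p.1 - ContinuousLinearMap.adjoint A p.2), A p.1 + p.2)) := by
    fun_prop
  have : IsProbabilityMeasure
      (((stdGaussian E).prod (stdGaussian F)).map (fun p : E × F => A p.1 + p.2)) :=
    Measure.isProbabilityMeasure_map m1.aemeasurable
  have : IsProbabilityMeasure (((stdGaussian E).prod (stdGaussian F)).map (fun p : E × F =>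
        (ContinuousLinearMap.adjoint B (p.1 - ContinuousLinearMap.adjoint A p.2), A p.1 + p.2))) :=
    Measure.isProbabilityMeasure_map m2.aemeasurable
  have pair : ∀ (a : E) (b : F),
      ∫ p : E × F, Complex.exp ((inner ℝ p.1 a + inner ℝ p.2 b : ℝ) * Complex.I)
        ∂((stdGaussian E).prod (stdGaussian F))
        = Complex.exp (-(‖a‖ ^ 2 + ‖b‖ ^ 2) / 2) := by
    intro a b
    have : ∀ p : E × F, Complex.exp ((inner ℝ p.1 a + inner ℝ p.2 b : ℝ) * Complex.I)
        = Complex.exp ((inner ℝ p.1 a : ℝ) * Complex.I) *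
          Complex.exp ((inner ℝ p.2 b : ℝ) * Complex.I) := by
      intro p; rw [← Complex.exp_add]; push_cast; ring_nf
    simp_rw [this]
    rw [integral_prod_mul (fun x : E => Complex.exp ((inner ℝ x a : ℝ) * Complex.I))
      (fun y : F => Complex.exp ((inner ℝ y b : ℝ) * Complex.I)), ← charFun_apply,
      ← charFun_apply, charFun_stdGaussian, charFun_stdGaussian, ← Complex.exp_add]
    ring_nf
  -- The law and the independence are both read off from the factorisation of the joint
  -- characteristic function.
  rw [← charFun_eq_prod_iff]
  intro t
  obtain ⟨⟨t, s⟩⟩ := t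
  rw [charFun_stdGaussian, charFun_apply, charFun_apply,
    integral_map (by fun_prop) (by fun_prop),
    integral_map (by fun_prop) (by fun_prop), integral_map (by fun_prop) (by fun_prop)]
  simp only [WithLp.prod_inner_apply]
  have h1 : ∀ p : E × F,
      inner ℝ (ContinuousLinearMap.adjoint B (p.1 - ContinuousLinearMap.adjoint A p.2)) t
        + inner ℝ (A p.1 + p.2) s
      = inner ℝ p.1 (B t + ContinuousLinearMap.adjoint A s) + inner ℝ p.2 (s - A (B t)) := by
    intro p
    simp only [ContinuousLinearMap.adjoint_inner_left, inner_sub_left, inner_add_left,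
      inner_add_right, inner_sub_right, ContinuousLinearMap.adjoint_inner_right]
    ring
  have h2 : ∀ p : E × F, inner ℝ (A p.1 + p.2) s
      = inner ℝ p.1 (ContinuousLinearMap.adjoint A s) + inner ℝ p.2 s := by
    intro p
    simp only [inner_add_left, ContinuousLinearMap.adjoint_inner_right]
  simp only [h1]
  simp only [h2, pair]
  rw [← Complex.exp_add]
  congr 1
  -- The cross terms 2⟨Bt, A†s⟩ and -2⟨s, ABt⟩ cancel; this is the independence. The remaining terms
  -- in t add up to ‖t‖² by `hB`.
  have hn : ‖B t + ContinuousLinearMap.adjoint A s‖ ^ 2 + ‖s - A (B t)‖ ^ 2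
      = ‖t‖ ^ 2 + (‖ContinuousLinearMap.adjoint A s‖ ^ 2 + ‖s‖ ^ 2) := by
    rw [norm_add_sq_real, norm_sub_sq_real, ContinuousLinearMap.adjoint_inner_right,
      real_inner_comm s, ← real_inner_self_eq_norm_sq t, ← hB t t, real_inner_self_eq_norm_sq,
      real_inner_self_eq_norm_sq]
    ring
  have hn' := congrArg (fun r : ℝ => (r : ℂ)) hn
  push_cast at hn'
  rw [hn']
  ring

end Gaussian

/-! ### The Gaussian density and shifted balls. -/

section Density

variable {ι : Type*} [Fintype ι]

/-- A finite product of standard real Gaussians has the product density. -/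
lemma pi_gaussianReal_eq_withDensity :
    Measure.pi (fun _ : ι => gaussianReal 0 1) =
      (volume : Measure (ι → ℝ)).withDensity
        (fun x => ENNReal.ofReal (∏ i, gaussianPDFReal 0 1 (x i))) := by
  refine (Measure.pi_eq (μ := fun _ : ι => gaussianReal 0 1) fun s hs => ?_)
  rw [withDensity_apply _ (MeasurableSet.univ_pi hs), ← lintegral_indicator (MeasurableSet.univ_pi hs)]
  have h1 : ∀ x : ι → ℝ, (Set.univ.pi s).indicator
      (fun x => ENNReal.ofReal (∏ i, gaussianPDFReal 0 1 (x i))) x =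
      ENNReal.ofReal (∏ i, (s i).indicator (gaussianPDFReal 0 1) (x i)) := by
    intro x
    by_cases hx : x ∈ Set.univ.pi s
    · rw [Set.indicator_of_mem hx]
      congr 1
      exact Finset.prod_congr rfl fun i _ => by
        rw [Set.indicator_of_mem (hx i (Set.mem_univ i))]
    · rw [Set.indicator_of_notMem hx]
      obtain ⟨i, hi⟩ : ∃ i, x i ∉ s i := by simpa [Set.mem_pi] using hx
      rw [Finset.prod_eq_zero (Finset.mem_univ i) (Set.indicator_of_notMem hi _),
        ENNReal.ofReal_zero]
  have hint : ∀ i, Integrable ((s i).indicator (gaussianPDFReal 0 1)) volume := fun i =>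
    (integrable_gaussianPDFReal 0 1).indicator (hs i)
  have hnn : ∀ i t, 0 ≤ (s i).indicator (gaussianPDFReal 0 1) t := fun i t =>
    Set.indicator_nonneg (fun t _ => gaussianPDFReal_nonneg 0 1 t) t
  simp_rw [h1]
  rw [volume_pi, ← ofReal_integral_eq_lintegral_ofReal (Integrable.fintype_prod hint)
    (ae_of_all _ fun x => Finset.prod_nonneg fun i _ => hnn i _),
    integral_fintype_prod_eq_prod (fun i t => (s i).indicator (gaussianPDFReal 0 1) t),
    ENNReal.ofReal_prod_of_nonneg fun i _ => integral_nonneg (hnn i)]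
  refine Finset.prod_congr rfl fun i _ => ?_
  rw [gaussianReal_apply_eq_integral 0 one_ne_zero, integral_indicator (hs i)]

/-- The density of the standard Gaussian measure. -/
lemma stdGaussian_eq_withDensity :
    stdGaussian (EuclideanSpace ℝ ι) = volume.withDensity (fun x =>
      ENNReal.ofReal (((√(2 * Real.pi))⁻¹) ^ Fintype.card ι * Real.exp (-‖x‖ ^ 2 / 2))) := by
  classical
  have hd : ∀ x : ι → ℝ, ∏ i, gaussianPDFReal 0 1 (x i) =
      ((√(2 * Real.pi))⁻¹) ^ Fintype.card ι * Real.exp (-‖WithLp.toLp 2 x‖ ^ 2 / 2) := by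
    intro x
    simp only [gaussianPDFReal_def, Finset.prod_mul_distrib, Finset.prod_const, Finset.card_univ,
      ← Real.exp_sum, EuclideanSpace.real_norm_sq_eq, sub_zero, NNReal.coe_one, mul_one]
    rw [← Finset.sum_div, Finset.sum_neg_distrib]
  rw [← map_pi_eq_stdGaussian, pi_gaussianReal_eq_withDensity]
  ext s hs
  have hm : Measurable (WithLp.toLp 2 : (ι → ℝ) → EuclideanSpace ℝ ι) := by fun_prop
  rw [Measure.map_apply hm hs, withDensity_apply _ (hm hs), withDensity_apply _ hs,
    ← (PiLp.volume_preserving_toLp ι).setLIntegral_comp_preimage hs (by fun_prop)]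
  simp_rw [hd]

/-- Among all balls of a given radius, the centred one has the largest Gaussian mass. -/
lemma stdGaussian_shifted_ball_le (m : EuclideanSpace ℝ ι) (s : ℝ) :
    stdGaussian (EuclideanSpace ℝ ι) {u | ‖m - u‖ ^ 2 ≤ s} ≤
      stdGaussian (EuclideanSpace ℝ ι) {u | ‖u‖ ^ 2 ≤ s} := by
  set S : Set (EuclideanSpace ℝ ι) := {u | ‖m - u‖ ^ 2 ≤ s} with hS
  set T : Set (EuclideanSpace ℝ ι) := {u | ‖u‖ ^ 2 ≤ s} with hT
  have mS : MeasurableSet S := measurableSet_le (by fun_prop) (by fun_prop)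
  have mT : MeasurableSet T := measurableSet_le (by fun_prop) (by fun_prop)
  have hvol : volume S = volume T := by
    have : S = (fun u => u + (-m)) ⁻¹' T := by
      ext u
      simp only [hS, hT, Set.mem_ofPred_eq, Set.mem_preimage]
      rw [← sub_eq_add_neg, norm_sub_rev]
    rw [this, measure_preimage_add_right]
  have hfin : volume T ≠ ∞ := by
    refine ((measure_mono ?_).trans_lt (measure_closedBall_lt_top (x := (0 : EuclideanSpace ℝ ι))
      (r := √s))).ne
    intro u hu
    rw [mem_closedBall_zero_iff]
    exact Real.le_sqrt_of_sq_le hu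
  -- Both balls have the same volume, so the parts outside the intersection do too. The density is
  -- at least `k`, its value on ‖x‖² = s, inside `T` and at most `k` outside.
  have hdiff : volume (S \ T) = volume (T \ S) := by
    have h1 := measure_inter_add_sdiff (μ := volume) S mT
    have h2 := measure_inter_add_sdiff (μ := volume) T mS
    rw [Set.inter_comm, hvol, ← h2] at h1
    exact (ENNReal.add_right_inj (measure_ne_top_of_subset Set.inter_subset_left hfin)).1 h1
  set k : ℝ≥0∞ := ENNReal.ofReal (((√(2 * Real.pi))⁻¹) ^ Fintype.card ι * Real.exp (-s / 2))
    with hk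
  have mono : ∀ a b : ℝ, a ≤ b →
      ENNReal.ofReal (((√(2 * Real.pi))⁻¹) ^ Fintype.card ι * Real.exp (-b / 2)) ≤
      ENNReal.ofReal (((√(2 * Real.pi))⁻¹) ^ Fintype.card ι * Real.exp (-a / 2)) := by
    intro a b hab
    gcongr
  have e1 : stdGaussian (EuclideanSpace ℝ ι) (S \ T) ≤ k * volume (S \ T) := by
    rw [stdGaussian_eq_withDensity, withDensity_apply _ (mS.diff mT), ← setLIntegral_const]
    exact setLIntegral_mono measurable_const fun u hu => mono _ _ (not_le.1 hu.2).le
  have e2 : k * volume (T \ S) ≤ stdGaussian (EuclideanSpace ℝ ι) (T \ S) := by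
    rw [stdGaussian_eq_withDensity, withDensity_apply _ (mT.diff mS), ← setLIntegral_const]
    exact setLIntegral_mono (by fun_prop) fun u hu => mono _ _ hu.1
  rw [← measure_inter_add_sdiff S mT, ← measure_inter_add_sdiff T mS, Set.inter_comm]
  exact add_le_add le_rfl (e1.trans (hdiff ▸ e2))

end Density

/-! ### The Bayes bound for a fixed design. -/

section Bayes

variable {ι : Type*} [Fintype ι]
  {F : Type*} [NormedAddCommGroup F] [InnerProductSpace ℝ F] [FiniteDimensional ℝ F]
  [MeasurableSpace F] [BorelSpace F]

/-- In the Gaussian linear model `Y = A G + ε` with standard Gaussian prior, no estimator of `G`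
has a better chance to fall in the ellipsoid `⟪(1 + A† A) v, v⟫ ≤ s` around `G` than the posterior
mean. -/
lemma prior_mass_le (A : EuclideanSpace ℝ ι →L[ℝ] F) (f : F → EuclideanSpace ℝ ι)
    (hf : Measurable f) (s : ℝ) :
    ((stdGaussian (EuclideanSpace ℝ ι)).prod (stdGaussian F))
      {p | ‖f (A p.1 + p.2) - p.1‖ ^ 2 + ‖A (f (A p.1 + p.2) - p.1)‖ ^ 2 ≤ s} ≤
      stdGaussian (EuclideanSpace ℝ ι) {u | ‖u‖ ^ 2 ≤ s} := by
  set Ad := ContinuousLinearMap.adjoint A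
  let M : EuclideanSpace ℝ ι →L[ℝ] EuclideanSpace ℝ ι := ContinuousLinearMap.id ℝ (EuclideanSpace ℝ ι) + Ad ∘L A
  have hM : ∀ u v, inner ℝ (M u) v = inner ℝ u v + inner ℝ (A u) (A v) := by
    intro u v
    simp [M, Ad, inner_add_left, ContinuousLinearMap.adjoint_inner_left]
  obtain ⟨B, hB⟩ := exists_whitening M
    (fun u v => by
      linarith [hM u v, hM v u, real_inner_comm u v, real_inner_comm (A u) (A v),
        real_inner_comm u (M v)])
    (fun v hv => by
      rw [hM]
      have := real_inner_self_pos.2 hv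
      have := real_inner_self_nonneg (x := A v)
      linarith)
  have hB' : ∀ u v, inner ℝ ((B : EuclideanSpace ℝ ι →L[ℝ] EuclideanSpace ℝ ι) u) ((B : EuclideanSpace ℝ ι →L[ℝ] EuclideanSpace ℝ ι) v)
      + inner ℝ (A ((B : EuclideanSpace ℝ ι →L[ℝ] EuclideanSpace ℝ ι) u)) (A ((B : EuclideanSpace ℝ ι →L[ℝ] EuclideanSpace ℝ ι) v)) = inner ℝ u v := by
    intro u v; rw [← hM]; exact hB u v
  have hlaw := map_residual_observation A (B : EuclideanSpace ℝ ι →L[ℝ] EuclideanSpace ℝ ι) hB'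
  set Bd := ContinuousLinearMap.adjoint (B : EuclideanSpace ℝ ι →L[ℝ] EuclideanSpace ℝ ι)
  have hnorm : ∀ v, ‖v‖ ^ 2 + ‖A v‖ ^ 2 = ‖B.symm v‖ ^ 2 := by
    intro v
    have := hB' (B.symm v) (B.symm v)
    simpa [real_inner_self_eq_norm_sq] using this
  -- In whitened coordinates the parameter is the residual plus the posterior mean, the latter a
  -- function of the observation alone.
  have hres : ∀ p : EuclideanSpace ℝ ι × F, B.symm p.1 = Bd (p.1 - Ad p.2) + Bd (Ad (A p.1 + p.2)) := by
    intro p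
    refine ext_inner_right ℝ fun w => ?_
    rw [inner_add_left, ContinuousLinearMap.adjoint_inner_left,
      ContinuousLinearMap.adjoint_inner_left, ← inner_add_left, ← hB' (B.symm p.1) w]
    simp [Ad, inner_add_left, ContinuousLinearMap.adjoint_inner_left]
  let h : EuclideanSpace ℝ ι × F → ℝ := fun q => ‖(B.symm (f q.2) - Bd (Ad q.2)) - q.1‖ ^ 2
  have mh : Measurable h := by
    have : Measurable (fun q : EuclideanSpace ℝ ι × F => B.symm (f q.2)) :=
      B.symm.continuous.measurable.comp (hf.comp measurable_snd)
    fun_prop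
  have hset : {p : EuclideanSpace ℝ ι × F | ‖f (A p.1 + p.2) - p.1‖ ^ 2 + ‖A (f (A p.1 + p.2) - p.1)‖ ^ 2 ≤ s}
      = (fun p : EuclideanSpace ℝ ι × F => (Bd (p.1 - Ad p.2), A p.1 + p.2)) ⁻¹' {q | h q ≤ s} := by
    ext p
    simp only [Set.mem_ofPred_eq, Set.mem_preimage, h, hnorm]
    rw [map_sub, hres p, sub_add_eq_sub_sub_swap]
  have ms : MeasurableSet {q | h q ≤ s} := measurableSet_le mh measurable_const
  have mpr : IsProbabilityMeasure
      (((stdGaussian (EuclideanSpace ℝ ι)).prod (stdGaussian F)).map (fun p : EuclideanSpace ℝ ι × F => A p.1 + p.2)) :=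
    Measure.isProbabilityMeasure_map (by fun_prop)
  rw [hset, ← Measure.map_apply (by fun_prop) ms, hlaw, Measure.prod_apply_symm ms]
  refine (lintegral_mono fun y => ?_).trans (le_of_eq (lintegral_const _)) |>.trans
    (by rw [measure_univ, mul_one])
  have hy : (fun u => (u, y)) ⁻¹' {q | h q ≤ s} =
      {u | ‖(B.symm (f y) - Bd (Ad y)) - u‖ ^ 2 ≤ s} := by
    ext u
    simp only [Set.mem_preimage, Set.mem_ofPred_eq, h]
  rw [hy]
  exact stdGaussian_shifted_ball_le (B.symm (f y) - Bd (Ad y)) s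

end Bayes

/-! ### Strict monotonicity of the χ² distribution function. -/

section ChiSquare

variable {d : ℕ}

lemma stdGaussian_isOpenPosMeasure : (stdGaussian (Vec d)).IsOpenPosMeasure := by
  have : (volume : Measure (Vec d)) ≪ stdGaussian (Vec d) := by
    rw [stdGaussian_eq_withDensity]
    refine withDensity_absolutelyContinuous' (by fun_prop) (ae_of_all _ fun x => ?_)
    have : 0 < ((√(2 * Real.pi))⁻¹) ^ Fintype.card (Fin d) * Real.exp (-‖x‖ ^ 2 / 2) := by
      positivity
    simpa using this
  exact this.isOpenPosMeasure

/-- The distribution function of `‖Z‖²` is strictly increasing on `[0, ∞)`. -/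
lemma stdGaussian_sq_lt (hd : 1 ≤ d) {s t : ℝ} (hs : 0 ≤ s) (hst : s < t) :
    stdGaussian (Vec d) {u | ‖u‖ ^ 2 ≤ s} < stdGaussian (Vec d) {u | ‖u‖ ^ 2 ≤ t} := by
  have := stdGaussian_isOpenPosMeasure (d := d)
  have ms : MeasurableSet {u : Vec d | ‖u‖ ^ 2 ≤ s} := measurableSet_le (by fun_prop) (by fun_prop)
  have ho : IsOpen {u : Vec d | s < ‖u‖ ^ 2 ∧ ‖u‖ ^ 2 < t} :=
    (isOpen_lt continuous_const (by fun_prop : Continuous fun u : Vec d => ‖u‖ ^ 2)).inter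
      (isOpen_lt (by fun_prop : Continuous fun u : Vec d => ‖u‖ ^ 2) continuous_const)
  have hne : {u : Vec d | s < ‖u‖ ^ 2 ∧ ‖u‖ ^ 2 < t}.Nonempty := by
    refine ⟨EuclideanSpace.single ⟨0, hd⟩ (√((s + t) / 2)), ?_⟩
    have : ‖(EuclideanSpace.single ⟨0, hd⟩ (√((s + t) / 2)) : Vec d)‖ ^ 2 = (s + t) / 2 := by
      rw [PiLp.norm_single, Real.norm_eq_abs, sq_abs, Real.sq_sqrt (by linarith)]
    simp only [Set.mem_ofPred_eq, this]
    constructor <;> linarith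
  have hpos := ho.measure_pos (stdGaussian (Vec d)) hne
  calc stdGaussian (Vec d) {u | ‖u‖ ^ 2 ≤ s}
      < stdGaussian (Vec d) {u | ‖u‖ ^ 2 ≤ s} +
          stdGaussian (Vec d) {u : Vec d | s < ‖u‖ ^ 2 ∧ ‖u‖ ^ 2 < t} :=
        ENNReal.lt_add_right (measure_ne_top _ _) hpos.ne'
    _ = stdGaussian (Vec d) ({u | ‖u‖ ^ 2 ≤ s} ∪ {u : Vec d | s < ‖u‖ ^ 2 ∧ ‖u‖ ^ 2 < t}) := by
        rw [measure_union' _ ms]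
        exact Set.disjoint_left.2 fun u h1 h2 => not_le.2 h2.1 h1
    _ ≤ _ := measure_mono fun u hu => by
        rcases hu with h | h
        · exact le_trans h hst.le
        · exact h.2.le

end ChiSquare

/-! ### Second-order expansion from differentiability of the gradient at one point. -/

section Expansion

/-- Second-order Taylor expansion at a critical point. -/
lemma eventually_abs_sub_quadratic_le {E : Type*} [NormedAddCommGroup E] [InnerProductSpace ℝ E]
    [CompleteSpace E] (f : E → ℝ) (H : E →L[ℝ] E)
    (hsym : ∀ u v, inner ℝ (H u) v = inner ℝ u (H v))
    (hdiff : ∀ᶠ x in 𝓝 (0 : E), DifferentiableAt ℝ f x) (h0 : gradient f 0 = 0)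
    (hH : HasFDerivAt (gradient f) H 0) {ε : ℝ} (hε : 0 < ε) :
    ∀ᶠ x in 𝓝 (0 : E), |f x - f 0 - inner ℝ (H x) x / 2| ≤ ε * ‖x‖ ^ 2 := by
  have h1 : ∀ᶠ x in 𝓝 (0 : E), ‖gradient f x - H x‖ ≤ ε * ‖x‖ := by
    have := hH.isLittleO.def hε
    simpa [h0] using this
  obtain ⟨r, hr, hball⟩ := Metric.eventually_nhds_iff_ball.1 (hdiff.and h1)
  filter_upwards [Metric.ball_mem_nhds (0 : E) hr] with x hx
  have hxr : ‖x‖ < r := by simpa using hx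
  -- The gradient of `q` is ∇f - H, of norm at most ε‖x‖ on the closed ball of radius ‖x‖; the mean
  -- value inequality supplies the second factor ‖x‖. No continuity of the Hessian is involved.
  let q : E → ℝ := fun y => f y - inner ℝ (H y) y / 2
  let q' : E → (E →L[ℝ] ℝ) := fun y => InnerProductSpace.toDual ℝ E (gradient f y - H y)
  have hq : ∀ y ∈ Metric.closedBall (0 : E) ‖x‖,
      HasFDerivWithinAt q (q' y) (Metric.closedBall (0 : E) ‖x‖) y := by
    intro y hy
    have hy' : y ∈ Metric.ball (0 : E) r := by
      rw [mem_closedBall_zero_iff] at hy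
      rw [mem_ball_zero_iff]; exact hy.trans_lt hxr
    have d1 : HasFDerivAt f (InnerProductSpace.toDual ℝ E (gradient f y)) y :=
      (hball y hy').1.hasGradientAt
    have d2 := (H.hasFDerivAt (x := y)).inner ℝ (hasFDerivAt_id y)
    have d3 := d1.sub (d2.const_mul (1 / 2 : ℝ))
    refine ((d3.congr_of_eventuallyEq (Eventually.of_forall fun z => ?_)).congr_fderiv
      ?_).hasFDerivWithinAt
    · simp only [q, Pi.sub_apply, id]
      ring
    · ext z
      have := hsym z y
      have hsw := real_inner_comm z (H y)
      simp only [q', map_sub, fderivInnerCLM_apply, _root_.sub_apply,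
        _root_.smul_apply, ContinuousLinearMap.comp_apply,
        ContinuousLinearMap.prod_apply, ContinuousLinearMap.id_apply, id, smul_eq_mul,
        InnerProductSpace.toDual_apply_apply]
      linarith
  have hb : ∀ y ∈ Metric.closedBall (0 : E) ‖x‖, ‖q' y‖ ≤ ε * ‖x‖ := by
    intro y hy
    rw [mem_closedBall_zero_iff] at hy
    have hy' : y ∈ Metric.ball (0 : E) r := by
      rw [mem_ball_zero_iff]; exact hy.trans_lt hxr
    calc ‖q' y‖ = ‖gradient f y - H y‖ := LinearIsometryEquiv.norm_map _ _
      _ ≤ ε * ‖y‖ := (hball y hy').2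
      _ ≤ ε * ‖x‖ := by gcongr
  have := (convex_closedBall (0 : E) ‖x‖).norm_image_sub_le_of_norm_hasFDerivWithin_le hq hb
    (x := 0) (y := x) (Metric.mem_closedBall_self (norm_nonneg x)) (by simp)
  simp only [q, map_zero, inner_zero_left, sub_zero, Real.norm_eq_abs, zero_div] at this
  calc |f x - f 0 - inner ℝ (H x) x / 2| = |f x - inner ℝ (H x) x / 2 - f 0| := by ring_nf
    _ ≤ _ := this
    _ = _ := by ring

end Expansion

/-! ### The second moment operator and its coercivity. -/

section SecondMoment

variable {d : ℕ}

/-- The second moment operator `𝔼[X Xᵀ]`. -/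
noncomputable def secondMoment (PX : Measure (Vec d)) : Vec d →L[ℝ] Vec d :=
  ∫ x, InnerProductSpace.rankOne ℝ x x ∂PX

variable {PX : Measure (Vec d)}

lemma inner_secondMoment (hint : Integrable (fun x : Vec d => InnerProductSpace.rankOne ℝ x x) PX)
    (u v : Vec d) :
    inner ℝ (secondMoment PX u) v = ∫ x, inner ℝ x u * inner ℝ x v ∂PX := by
  rw [secondMoment, ContinuousLinearMap.integral_apply hint, real_inner_comm,
    ← integral_inner (hint.apply_continuousLinearMap u)]
  refine integral_congr_ae (ae_of_all _ fun x => ?_)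
  simp only [InnerProductSpace.rankOne_apply, inner_smul_right, real_inner_comm x v]

lemma integrable_inner_mul_inner
    (hint : Integrable (fun x : Vec d => InnerProductSpace.rankOne ℝ x x) PX) (u v : Vec d) :
    Integrable (fun x => inner ℝ x u * inner ℝ x v) PX := by
  refine ((hint.apply_continuousLinearMap u).const_inner v).congr (ae_of_all _ fun x => ?_)
  simp only [InnerProductSpace.rankOne_apply, inner_smul_right, real_inner_comm x v]

lemma secondMoment_symm (hint : Integrable (fun x : Vec d => InnerProductSpace.rankOne ℝ x x) PX)
    (u v : Vec d) : inner ℝ (secondMoment PX u) v = inner ℝ u (secondMoment PX v) := by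
  rw [real_inner_comm _ u, inner_secondMoment hint, inner_secondMoment hint]
  simp_rw [mul_comm]

/-- A null direction v would satisfy 𝔼⟨X, v⟩² = 0, placing X almost surely in the hyperplane
orthogonal to v. -/
lemma secondMoment_pos (hint : Integrable (fun x : Vec d => InnerProductSpace.rankOne ℝ x x) PX)
    (hne : ∀ w : Vec d, w ≠ 0 → ¬ ∀ᵐ x ∂PX, inner ℝ w x = 0) {v : Vec d} (hv : v ≠ 0) :
    0 < inner ℝ (secondMoment PX v) v := by
  rw [inner_secondMoment hint]
  refine lt_of_le_of_ne (integral_nonneg fun x => mul_self_nonneg _) fun h => hne v hv ?_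
  have := (integral_eq_zero_iff_of_nonneg (fun x => mul_self_nonneg (inner ℝ x v))
    (integrable_inner_mul_inner hint v v)).1 h.symm
  filter_upwards [this] with x hx
  rw [real_inner_comm]
  exact mul_self_eq_zero.1 hx

/-- The constant is the minimum of the form on the compact unit sphere, which is empty only in the
zero space. -/
lemma exists_coercive {E : Type*} [NormedAddCommGroup E] [InnerProductSpace ℝ E]
    [FiniteDimensional ℝ E] (S : E →L[ℝ] E) (hpos : ∀ v, v ≠ 0 → 0 < inner ℝ (S v) v) :
    ∃ c > 0, ∀ v, c * ‖v‖ ^ 2 ≤ inner ℝ (S v) v := by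
  rcases (Metric.sphere (0 : E) 1).eq_empty_or_nonempty with he | hne
  · refine ⟨1, one_pos, fun v => ?_⟩
    have : v = 0 := by
      by_contra hv
      have : (‖v‖⁻¹ • v) ∈ Metric.sphere (0 : E) 1 := by
        simp [norm_smul, norm_ne_zero_iff.2 hv]
      rw [he] at this
      exact this
    simp [this]
  · obtain ⟨u, hu, hmin⟩ := (isCompact_sphere (0 : E) 1).exists_isMinOn hne
      (f := fun v => inner ℝ (S v) v) (by fun_prop)
    have hu0 : u ≠ 0 := by
      rintro rfl; simp at hu
    refine ⟨inner ℝ (S u) u, hpos u hu0, fun v => ?_⟩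
    rcases eq_or_ne v 0 with rfl | hv
    · simp
    have hn := norm_ne_zero_iff.2 hv
    have h := hmin (show (‖v‖⁻¹ • v) ∈ Metric.sphere (0 : E) 1 by simp [norm_smul, hn])
    simp only [Set.mem_ofPred_eq, map_smul, inner_smul_left, inner_smul_right, conj_trivial] at h
    calc inner ℝ (S u) u * ‖v‖ ^ 2 ≤ (‖v‖⁻¹ * (‖v‖⁻¹ * inner ℝ (S v) v)) * ‖v‖ ^ 2 := by gcongr
      _ = inner ℝ (S v) v := by field_simp

end SecondMoment

/-! ### The expected loss: positivity of α, convexity, symmetry. -/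

section Loss

/-- The second derivative of a strictly convex function has positive Gaussian mean. -/
lemma integral_deriv_deriv_pos {e : ℝ → ℝ} (hconv : StrictConvexOn ℝ Set.univ e)
    (hd : Differentiable ℝ e) (hd2 : Differentiable ℝ (deriv e)) {v : ℝ≥0} (hv : v ≠ 0)
    (hint : Integrable (deriv (deriv e)) (gaussianReal 0 v)) :
    0 < ∫ t, deriv (deriv e) t ∂(gaussianReal 0 v) := by
  have hmono : Monotone (deriv e) := by
    have := hconv.convexOn.monotoneOn_deriv (fun x _ => hd x)
    exact fun a b h => this (Set.mem_univ a) (Set.mem_univ b) h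
  have hnn : 0 ≤ deriv (deriv e) := fun x => hmono.deriv_nonneg
  refine lt_of_le_of_ne (integral_nonneg hnn) fun h => ?_
  have h0 : deriv (deriv e) =ᵐ[volume] 0 :=
    (gaussianReal_absolutelyContinuous' 0 hv).ae_le
      ((integral_eq_zero_iff_of_nonneg hnn hint).1 h.symm)
  -- Almost everywhere vanishing of e'' suffices because e' is differentiable at every point and e''
  -- is integrable, so the fundamental theorem of calculus applies.
  have hconst : ∀ b, deriv e b = deriv e 0 := by
    intro b
    have hi : IntervalIntegrable (deriv (deriv e)) volume 0 b :=
      (intervalIntegrable_const (c := (0 : ℝ))).congr_ae (ae_restrict_of_ae h0.symm)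
    have := intervalIntegral.integral_eq_sub_of_hasDerivAt
      (fun x _ => (hd2 x).hasDerivAt) hi
    rw [intervalIntegral.integral_congr_ae (g := fun _ => (0 : ℝ))
      (h0.mono fun x hx _ => hx)] at this
    simp at this
    linarith
  have haff : ∀ x, e x = e 0 + deriv e 0 * x := by
    intro x
    have hz : ∀ y, deriv (fun y => e y - deriv e 0 * y) y = 0 := by
      intro y
      rw [deriv_fun_sub (hd y) (by fun_prop), deriv_const_mul_id', hconst y, sub_self]
    have := is_const_of_deriv_eq_zero (f := fun y => e y - deriv e 0 * y) (by fun_prop) hz x 0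
    simp at this
    linarith
  have := hconv.2 (Set.mem_univ (0 : ℝ)) (Set.mem_univ 1) zero_ne_one
    (by norm_num : (0 : ℝ) < 1 / 2) (by norm_num : (0 : ℝ) < 1 / 2) (by norm_num)
  simp only [smul_eq_mul] at this
  rw [haff (1 / 2 * 0 + 1 / 2 * 1), haff 1] at this
  linarith

variable {d : ℕ} {PX : Measure (Vec d)} {σ : ℝ≥0} {e : ℝ → ℝ}

lemma convexOn_Etilde (hconv : ConvexOn ℝ Set.univ e)
    (hint : ∀ Δ : Vec d, Integrable (fun z : Vec d × ℝ => e (inner ℝ Δ z.1 + z.2))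
      (inputNoise PX σ)) :
    ConvexOn ℝ Set.univ (Etilde e PX σ) := by
  refine ⟨convex_univ, fun x _ y _ a b ha hb hab => ?_⟩
  simp only [Etilde, smul_eq_mul]
  rw [← integral_const_mul, ← integral_const_mul,
    ← integral_add ((hint x).const_mul a) ((hint y).const_mul b)]
  refine integral_mono (hint _) (((hint x).const_mul a).add ((hint y).const_mul b)) fun z => ?_
  have := hconv.2 (Set.mem_univ (inner ℝ x z.1 + z.2)) (Set.mem_univ (inner ℝ y z.1 + z.2))
    ha hb hab
  simp only [smul_eq_mul] at this
  convert this using 2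
  simp only [inner_add_left, inner_smul_left, conj_trivial]
  linear_combination (-z.2) * hab

variable [IsProbabilityMeasure PX]

instance : IsProbabilityMeasure (inputNoise PX σ) := by
  unfold inputNoise; infer_instance

lemma measurePreserving_neg_noise :
    MeasurePreserving (fun z : Vec d × ℝ => (z.1, -z.2)) (inputNoise PX σ) (inputNoise PX σ) := by
  have h : MeasurePreserving (fun t : ℝ => -t) (gaussianReal 0 (σ ^ 2)) (gaussianReal 0 (σ ^ 2)) :=
    ⟨measurable_neg, by rw [gaussianReal_map_neg, neg_zero]⟩
  exact (MeasurePreserving.id PX).prod h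

/-- Integrability of `e''(η) X Xᵀ` splits over the two independent factors. -/
lemma integrable_of_integrable_hessian (hd : 1 ≤ d) (hσ : 0 < σ)
    (hne : ∀ w : Vec d, w ≠ 0 → ¬ ∀ᵐ x ∂PX, inner ℝ w x = 0)
    (hconv : StrictConvexOn ℝ Set.univ e) (hd1 : Differentiable ℝ e)
    (hd2 : Differentiable ℝ (deriv e))
    (hH : Integrable (fun z : Vec d × ℝ =>
      deriv (deriv e) z.2 • InnerProductSpace.rankOne ℝ z.1 z.1) (inputNoise PX σ)) :
    Integrable (deriv (deriv e)) (gaussianReal 0 (σ ^ 2)) ∧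
      Integrable (fun x : Vec d => InnerProductSpace.rankOne ℝ x x) PX := by
  have hσ2 : σ ^ 2 ≠ 0 := by positivity
  have hint : Integrable (deriv (deriv e)) (gaussianReal 0 (σ ^ 2)) := by
    have h1 := Integrable.prod_right_ae hH
    have hw : (EuclideanSpace.single ⟨0, hd⟩ (1 : ℝ) : Vec d) ≠ 0 := by simp
    -- Almost every section is integrable, and nonzero x have positive probability; at one such x
    -- the constant factor ‖x‖² can be divided out.
    have h2 : ∃ᵐ x ∂PX, inner ℝ (EuclideanSpace.single ⟨0, hd⟩ (1 : ℝ) : Vec d) x ≠ 0 :=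
      fun h => hne _ hw (h.mono fun x hx => not_not.1 hx)
    obtain ⟨x, hx, hxi⟩ := (h2.and_eventually h1).exists
    have hx0 : x ≠ 0 := by rintro rfl; simp at hx
    have h3 := hxi.norm
    simp only [norm_smul, InnerProductSpace.norm_rankOne] at h3
    have h4 := h3.mul_const (‖x‖ * ‖x‖)⁻¹
    have hn := norm_ne_zero_iff.2 hx0
    refine (integrable_norm_iff (measurable_deriv _).aestronglyMeasurable).1 (h4.congr ?_)
    exact ae_of_all _ fun t => by field_simp
  refine ⟨hint, ?_⟩
  have hpos := integral_deriv_deriv_pos hconv hd1 hd2 hσ2 hint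
  have h1 := Integrable.prod_left_ae hH
  have h2 : ∃ᵐ t ∂(gaussianReal 0 (σ ^ 2)), deriv (deriv e) t ≠ 0 := by
    intro h
    rw [integral_eq_zero_of_ae (by filter_upwards [h] with t ht using not_not.1 ht)] at hpos
    exact lt_irrefl _ hpos
  obtain ⟨t, ht, hti⟩ := (h2.and_eventually h1).exists
  exact (integrable_smul_iff ht _).1 hti

lemma integral_hessian :
    ∫ z : Vec d × ℝ, deriv (deriv e) z.2 • InnerProductSpace.rankOne ℝ z.1 z.1 ∂(inputNoise PX σ)
      = (∫ t, deriv (deriv e) t ∂(gaussianReal 0 (σ ^ 2))) • secondMoment PX := by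
  rw [inputNoise, ← integral_prod_swap, secondMoment]
  exact integral_prod_smul (deriv (deriv e)) (fun x : Vec d => InnerProductSpace.rankOne ℝ x x)

/-- Replace η by -η, which has the same law, and use that e is even. -/
lemma Etilde_neg (heven : ∀ t, e (-t) = e t) (Δ : Vec d) :
    Etilde e PX σ (-Δ) = Etilde e PX σ Δ := by
  have h := (measurePreserving_neg_noise (PX := PX) (σ := σ)).integral_comp'
    (f := (MeasurableEquiv.refl _).prodCongr (MeasurableEquiv.neg ℝ))
    (fun z => e (inner ℝ Δ z.1 + z.2))
  rw [Etilde, Etilde, ← h]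
  refine integral_congr_ae (ae_of_all _ fun z => ?_)
  simp only [inner_neg_left]
  rw [← heven]
  congr 1
  simp [MeasurableEquiv.prodCongr, MeasurableEquiv.neg]
  ring

lemma expectedError_eq (heven : ∀ t, e (-t) = e t) (he : Continuous e) (wstar w : Vec d) :
    expectedError e ((inputNoise PX σ).map fun z => (z.1, inner ℝ wstar z.1 + z.2)) w =
      Etilde e PX σ (w - wstar) := by
  rw [expectedError, integral_map (by fun_prop) (by fun_prop), ← Etilde_neg heven, Etilde]
  refine integral_congr_ae (ae_of_all _ fun z => ?_)
  simp only
  rw [← heven]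
  congr 1
  simp only [inner_sub_left, inner_neg_left]
  ring

/-- The origin is the midpoint of Δ and -Δ, where Ẽ takes equal values. -/
lemma Etilde_zero_le (heven : ∀ t, e (-t) = e t) (hconv : ConvexOn ℝ Set.univ e)
    (hint : ∀ Δ : Vec d, Integrable (fun z : Vec d × ℝ => e (inner ℝ Δ z.1 + z.2))
      (inputNoise PX σ)) (Δ : Vec d) :
    Etilde e PX σ 0 ≤ Etilde e PX σ Δ := by
  have := (convexOn_Etilde hconv hint).2 (Set.mem_univ Δ) (Set.mem_univ (-Δ))
    (by norm_num : (0 : ℝ) ≤ 1 / 2) (by norm_num : (0 : ℝ) ≤ 1 / 2) (by norm_num)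
  rw [Etilde_neg heven, smul_neg, add_neg_cancel] at this
  simp only [smul_eq_mul] at this
  linarith

/-- The excess error depends on `w` only through `w - w*`. -/
lemma excessError_eq (heven : ∀ t, e (-t) = e t) (he : Continuous e)
    (hconv : ConvexOn ℝ Set.univ e)
    (hint : ∀ Δ : Vec d, Integrable (fun z : Vec d × ℝ => e (inner ℝ Δ z.1 + z.2))
      (inputNoise PX σ)) (wstar w : Vec d) :
    excessError e ((inputNoise PX σ).map fun z => (z.1, inner ℝ wstar z.1 + z.2)) w =
      Etilde e PX σ (w - wstar) - Etilde e PX σ 0 := by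
  simp only [excessError, expectedError_eq heven he]
  congr 1
  have hle := Etilde_zero_le heven hconv hint
  refine le_antisymm ?_ (le_ciInf fun v => hle _)
  have := ciInf_le ⟨Etilde e PX σ 0, by rintro _ ⟨v, rfl⟩; exact hle (v - wstar)⟩ wstar
  simpa using this

end Loss

/-! ### Sublevel sets of the excess error versus ellipsoids. -/

section LocalShape

variable {d : ℕ}

/-- Near its minimum, a convex function with quadratic expansion `α ⟪S Δ, Δ⟫` is bounded above by
a slightly larger quadratic form. -/
lemma exists_le_quadratic {g : Vec d → ℝ} {S : Vec d →L[ℝ] Vec d} {α : ℝ} (hα : 0 < α)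
    (hpos : ∀ v, v ≠ 0 → 0 < inner ℝ (S v) v)
    (hexp : ∀ ε > 0, ∀ᶠ x in 𝓝 (0 : Vec d), |g x - α * inner ℝ (S x) x| ≤ ε * ‖x‖ ^ 2)
    {ε : ℝ} (hε : 0 < ε) :
    ∃ s > 0, ∀ x, inner ℝ (S x) x ≤ s → g x ≤ α * (1 + ε) * inner ℝ (S x) x := by
  obtain ⟨c, hc, hcoer⟩ := exists_coercive S hpos
  -- With this tolerance, coercivity bounds the Taylor error by αε⟨Sx, x⟩, a relative error.
  obtain ⟨r, hr, hball⟩ := Metric.eventually_nhds_iff_ball.1 (hexp (α * ε * c) (by positivity))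
  refine ⟨c * (r / 2) ^ 2, by positivity, fun x hx => ?_⟩
  have hxr : ‖x‖ < r := by
    have : ‖x‖ ≤ r / 2 := by
      refine le_of_sq_le_sq ?_ (by positivity)
      exact le_of_mul_le_mul_left ((hcoer x).trans hx) hc
    linarith
  have h1 := (abs_le.1 (hball x (by simpa using hxr))).2
  have h2 := mul_le_mul_of_nonneg_left (hcoer x) (by positivity : 0 ≤ α * ε)
  nlinarith

/-- A sufficiently low sublevel set of a convex function with quadratic expansion `α ⟪S Δ, Δ⟫` at
its minimum is contained in a slightly larger ellipsoid. -/
lemma exists_quadratic_le {g : Vec d → ℝ} {S : Vec d →L[ℝ] Vec d} {α : ℝ} (hα : 0 < α)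
    (hpos : ∀ v, v ≠ 0 → 0 < inner ℝ (S v) v) (hg : ConvexOn ℝ Set.univ g) (hg0 : g 0 = 0)
    (hexp : ∀ ε > 0, ∀ᶠ x in 𝓝 (0 : Vec d), |g x - α * inner ℝ (S x) x| ≤ ε * ‖x‖ ^ 2)
    {ε : ℝ} (hε : 0 < ε) (hε1 : ε < 1) :
    ∃ t > 0, ∀ x, g x ≤ t → α * (1 - ε) * inner ℝ (S x) x ≤ g x := by
  obtain ⟨c, hc, hcoer⟩ := exists_coercive S hpos
  obtain ⟨r, hr, hball⟩ := Metric.eventually_nhds_iff_ball.1 (hexp (α * ε * c) (by positivity))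
  have h1e : 0 < 1 - ε := by linarith
  have key : ∀ x : Vec d, ‖x‖ < r → α * (1 - ε) * inner ℝ (S x) x ≤ g x := by
    intro x hx
    have h1 := (abs_le.1 (hball x (by simpa using hx))).1
    have h2 := mul_le_mul_of_nonneg_left (hcoer x) (by positivity : 0 ≤ α * ε)
    nlinarith
  -- Half of a lower bound for `g` on the sphere of radius r/2. A point with ‖x‖ ≥ r, shrunk onto
  -- that sphere, would by convexity have g(ax) ≤ a g(x) ≤ g(x), which is too small.
  refine ⟨α * (1 - ε) * (c * (r / 2) ^ 2) / 2, by positivity, fun x hx => ?_⟩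
  refine key x ?_
  by_contra hxr
  push Not at hxr
  have hx0 : 0 < ‖x‖ := hr.trans_le hxr
  set a := r / 2 / ‖x‖ with ha
  have ha0 : 0 < a := by positivity
  have ha1 : a ≤ 1 := by
    rw [ha, div_le_one hx0]; linarith
  have hna : ‖a • x‖ = r / 2 := by
    rw [norm_smul, Real.norm_eq_abs, abs_of_pos ha0, ha, div_mul_cancel₀ _ hx0.ne']
  have h1 := key (a • x) (by rw [hna]; linarith)
  have h2 := hcoer (a • x)
  rw [hna] at h2
  have h3 := hg.2 (Set.mem_univ x) (Set.mem_univ 0) ha0.le (by linarith : 0 ≤ 1 - a) (by ring)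
  rw [smul_zero, add_zero, hg0, smul_zero, add_zero, smul_eq_mul] at h3
  have h4 := mul_le_mul_of_nonneg_left h2 (by positivity : 0 ≤ α * (1 - ε))
  have hP : 0 < α * (1 - ε) * (c * (r / 2) ^ 2) := by positivity
  have hgx : 0 < g x := by
    by_contra hneg
    push Not at hneg
    have := mul_nonpos_of_nonneg_of_nonpos ha0.le hneg
    linarith
  have h5 : a * g x ≤ g x := by nlinarith
  linarith

end LocalShape

/-! ### Concentration of the empirical second moment. -/

section LawOfLargeNumbers

variable {d : ℕ}

lemma continuous_rankOne_self : Continuous (fun x : Vec d => InnerProductSpace.rankOne ℝ x x) :=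
  (InnerProductSpace.rankOne ℝ).continuous.clm_apply continuous_id

lemma measurableSet_sampleMoment {n : ℕ} (S : Vec d →L[ℝ] Vec d) (ε : ℝ) :
    MeasurableSet {x : Fin n → Vec d |
      ε ≤ ‖(n : ℝ)⁻¹ • ∑ i, InnerProductSpace.rankOne ℝ (x i) (x i) - S‖} := by
  refine measurableSet_le measurable_const (Measurable.norm (Measurable.sub_const ?_ _))
  have h : Measurable (fun x : Fin n → Vec d => ∑ i, InnerProductSpace.rankOne ℝ (x i) (x i)) :=
    Finset.measurable_fun_sum _ fun i _ =>
      continuous_rankOne_self.measurable.comp (measurable_pi_apply i)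
  exact h.const_smul ((n : ℝ)⁻¹)

variable {PX : Measure (Vec d)} [IsProbabilityMeasure PX]

/-- Weak law of large numbers for the empirical second moment operator. -/
lemma tendsto_measure_sampleMoment
    (hint : Integrable (fun x : Vec d => InnerProductSpace.rankOne ℝ x x) PX)
    {ε : ℝ} (hε : 0 < ε) :
    Tendsto (fun n : ℕ => (Measure.pi fun _ : Fin n => PX)
      {x | ε ≤ ‖(n : ℝ)⁻¹ • ∑ i, InnerProductSpace.rankOne ℝ (x i) (x i) - secondMoment PX‖})
      atTop (𝓝 0) := by
  -- Samples of all sizes are realised on one infinite product, where the operator-valued strong law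
  -- applies; only integrability of XXᵀ is needed. Convergence in measure is then transferred to
  -- each finite product.
  let μ : Measure (ℕ → Vec d) := Measure.infinitePi fun _ => PX
  let r : Vec d → (Vec d →L[ℝ] Vec d) := fun x => InnerProductSpace.rankOne ℝ x x
  have hr : Measurable r := continuous_rankOne_self.measurable
  let X : ℕ → (ℕ → Vec d) → (Vec d →L[ℝ] Vec d) := fun i ω => r (ω i)
  have hind : iIndepFun (fun (i : ℕ) (ω : ℕ → Vec d) => ω i) μ :=
    iIndepFun_infinitePi (P := fun _ : ℕ => PX) (X := fun _ (ω : Vec d) => ω) (by fun_prop)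
  have hlaw : ∀ i, μ.map (fun ω => ω i) = PX := fun i =>
    Measure.infinitePi_map_eval (fun _ : ℕ => PX) i
  have hid : ∀ i, IdentDistrib (fun ω : ℕ → Vec d => ω i) (fun ω => ω 0) μ μ := fun i =>
    ⟨(measurable_pi_apply i).aemeasurable, (measurable_pi_apply 0).aemeasurable,
      by rw [hlaw, hlaw]⟩
  have hX0 : Integrable (X 0) μ := by
    have : Integrable r (μ.map fun ω => ω 0) := by rw [hlaw]; exact hint
    exact this.comp_measurable (measurable_pi_apply 0)
  have hmean : μ[X 0] = secondMoment PX := by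
    have := integral_map (μ := μ) (φ := fun ω : ℕ → Vec d => ω 0)
      (measurable_pi_apply 0).aemeasurable
      (f := r) hr.aestronglyMeasurable
    rw [hlaw] at this
    exact this.symm
  have hslln := strong_law_ae X hX0
    (fun i j hij => (hind.indepFun hij).comp hr hr) (fun i => (hid i).comp hr)
  have hmeas : ∀ n : ℕ, AEStronglyMeasurable
      (fun ω => (n : ℝ)⁻¹ • (∑ i ∈ Finset.range n, X i ω)) μ := fun n => by
    refine Measurable.aestronglyMeasurable ?_
    have h : Measurable (fun ω => ∑ i ∈ Finset.range n, X i ω) :=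
      Finset.measurable_fun_sum _ fun i _ => hr.comp (measurable_pi_apply i)
    exact h.const_smul ((n : ℝ)⁻¹)
  rw [hmean] at hslln
  have hin := tendstoInMeasure_of_tendsto_ae hmeas hslln
  rw [tendstoInMeasure_iff_norm] at hin
  refine (hin ε hε).congr fun n => ?_
  have hpi : Measure.pi (fun _ : Fin n => PX) = μ.map (fun ω (i : Fin n) => ω i) := by
    rw [Measure.map_infinitePi_infinitePi_of_inj (P := fun _ : ℕ => PX) Fin.val_injective,
      Measure.infinitePi_eq_pi]
  rw [hpi, Measure.map_apply (by fun_prop) (measurableSet_sampleMoment _ _)]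
  congr 1
  ext ω
  simp only [Set.mem_preimage, Set.mem_ofPred_eq, X, r, Finset.sum_range]

/-- If the empirical second moment operator is close to the true one, then the empirical quadratic
form is equivalent to the true one with constants close to `1`. -/
lemma sampleMoment_bounds {S : Vec d →L[ℝ] Vec d} {c ε : ℝ} (hε : 0 < ε)
    (hcoer : ∀ v, c * ‖v‖ ^ 2 ≤ inner ℝ (S v) v) {n : ℕ} (hn : 0 < n) {x : Fin n → Vec d}
    (hx : ‖(n : ℝ)⁻¹ • ∑ i, InnerProductSpace.rankOne ℝ (x i) (x i) - S‖ < ε * c) (v : Vec d) :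
    |∑ i, (inner ℝ (x i) v) ^ 2 - n * inner ℝ (S v) v| ≤ n * (ε * inner ℝ (S v) v) := by
  have hn' : (0 : ℝ) < n := by exact_mod_cast hn
  set T := (n : ℝ)⁻¹ • ∑ i, InnerProductSpace.rankOne ℝ (x i) (x i) - S with hT
  -- Coercivity turns an operator norm error below εc into a relative error ε.
  have h1 : |inner ℝ (T v) v| ≤ ε * inner ℝ (S v) v := by
    calc |inner ℝ (T v) v| ≤ ‖T v‖ * ‖v‖ := abs_real_inner_le_norm _ _
      _ ≤ (‖T‖ * ‖v‖) * ‖v‖ := by gcongr; exact T.le_opNorm v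
      _ ≤ ((ε * c) * ‖v‖) * ‖v‖ := by gcongr
      _ = ε * (c * ‖v‖ ^ 2) := by ring
      _ ≤ _ := by gcongr; exact hcoer v
  have h2 : ∑ i, (inner ℝ (x i) v) ^ 2 - n * inner ℝ (S v) v = n * inner ℝ (T v) v := by
    rw [hT]
    simp only [_root_.sub_apply, _root_.smul_apply, _root_.sum_apply,
      InnerProductSpace.rankOne_apply, inner_sub_left, inner_smul_left, sum_inner, conj_trivial]
    rw [mul_sub, ← mul_assoc, mul_inv_cancel₀ hn'.ne', one_mul]
    simp only [sq]
  rw [h2, abs_mul, abs_of_pos hn']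
  gcongr

end LawOfLargeNumbers

/-! ### Passing between quantiles and probabilities. -/

section Quantile

variable {Ω : Type*} [MeasurableSpace Ω] {μ : Measure Ω} {f : Ω → ℝ} {p t : ℝ}

lemma quantile_le (ht : 0 ≤ t) (h : ENNReal.ofReal p ≤ μ {ω | f ω ≤ t}) :
    quantile μ f p ≤ ENNReal.ofReal t := by
  refine (iInf₂_le (⟨t, ht⟩ : ℝ≥0) h).trans (le_of_eq ?_)
  rw [ENNReal.ofReal, Real.toNNReal_of_nonneg ht]
  rfl

lemma le_quantile (h : μ {ω | f ω ≤ t} < ENNReal.ofReal p) :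
    ENNReal.ofReal t ≤ quantile μ f p := by
  refine le_iInf₂ fun s hs => ?_
  rw [← ENNReal.ofReal_coe_nnreal]
  refine ENNReal.ofReal_le_ofReal ?_
  by_contra hst
  push Not at hst
  exact absurd (hs.trans (measure_mono fun ω (hω : f ω ≤ s) => hω.trans hst.le)) (not_le.2 h)

/-- The strict inequality avoids the question whether the infimum is attained. -/
lemma le_measure_of_quantile_lt (h : quantile μ f p < ENNReal.ofReal t) :
    ENNReal.ofReal p ≤ μ {ω | f ω ≤ t} := by
  by_contra hlt
  exact absurd (le_quantile (not_le.1 hlt)) (not_le.2 h)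

end Quantile

/-! ### Two-sided bounds for the χ² quantile. -/

section ChiSquareBounds

variable {d : ℕ}

lemma lintegral_exp_sq_stdGaussian {b : ℝ} (hb : 0 < b) :
    ∫⁻ u : Vec d, ENNReal.ofReal (Real.exp ((1 / 2 - b) * ‖u‖ ^ 2)) ∂(stdGaussian (Vec d)) =
      ENNReal.ofReal ((√(2 * b))⁻¹ ^ d) := by
  have hI := GaussianFourier.integral_rexp_neg_mul_sq_norm (V := Vec d) hb
  have hpos : 0 < (Real.pi / b) ^ (Module.finrank ℝ (Vec d) / 2 : ℝ) := by positivity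
  have hint : Integrable (fun v : Vec d => Real.exp (-b * ‖v‖ ^ 2)) volume :=
    Integrable.of_integral_ne_zero (by rw [hI]; exact hpos.ne')
  rw [stdGaussian_eq_withDensity, lintegral_withDensity_eq_lintegral_mul _ (by fun_prop)
    (by fun_prop)]
  have h1 : ∀ u : Vec d, ENNReal.ofReal (((√(2 * Real.pi))⁻¹) ^
      Fintype.card (Fin d) * Real.exp (-‖u‖ ^ 2 / 2)) *
      ENNReal.ofReal (Real.exp ((1 / 2 - b) * ‖u‖ ^ 2)) =
      ENNReal.ofReal (((√(2 * Real.pi))⁻¹) ^ d * Real.exp (-b * ‖u‖ ^ 2)) := by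
    intro u
    rw [← ENNReal.ofReal_mul (by positivity), mul_assoc, ← Real.exp_add,
      Fintype.card_fin]
    ring_nf
  simp only [Pi.mul_apply, h1]
  rw [← ofReal_integral_eq_lintegral_ofReal (hint.const_mul _)
    (ae_of_all _ fun u => by positivity), integral_const_mul, hI]
  congr 1
  rw [finrank_euclideanSpace_fin, Real.rpow_div_two_eq_sqrt _ (by positivity), Real.rpow_natCast,
    ← mul_pow, ← Real.sqrt_inv, ← Real.sqrt_inv, ← Real.sqrt_mul (by positivity)]
  congr 2
  field_simp

/-- Chernoff bound with 𝔼 exp(‖Z‖²/4) = (√2)^d ≤ e^d; the threshold is chosen so that e^d = δ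
e^(t/4). -/
lemma chiSquare_upper_tail {δ : ℝ} (hδ : δ ∈ Set.Ioo (0 : ℝ) 1) :
    quantile (stdGaussian (Vec d)) (fun z => ‖z‖ ^ 2) (1 - δ) ≤
      ENNReal.ofReal (4 * (d + Real.log (1 / δ))) := by
  have hL : 0 ≤ Real.log (1 / δ) := Real.log_nonneg (by rw [le_div_iff₀ hδ.1]; linarith [hδ.2])
  set t := 4 * (d + Real.log (1 / δ)) with ht
  have ht0 : 0 ≤ t := by positivity
  refine quantile_le ht0 ?_
  have ms : MeasurableSet {u : Vec d | ‖u‖ ^ 2 ≤ t} := measurableSet_le (by fun_prop) (by fun_prop)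
  have hI := lintegral_exp_sq_stdGaussian (d := d) (b := 1 / 4) (by norm_num)
  have hmarkov : ENNReal.ofReal (Real.exp (t / 4)) * stdGaussian (Vec d) {u | ‖u‖ ^ 2 ≤ t}ᶜ ≤
      ENNReal.ofReal ((√(2 * (1 / 4)))⁻¹ ^ d) := by
    rw [← hI]
    refine le_trans ?_ (mul_meas_ge_le_lintegral₀ (by fun_prop)
      (ENNReal.ofReal (Real.exp (t / 4))))
    gcongr
    intro u hu
    have hu' : t < ‖u‖ ^ 2 := not_le.1 hu
    refine ENNReal.ofReal_le_ofReal (Real.exp_le_exp.2 ?_)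
    linarith
  have hbound : (√(2 * (1 / 4)))⁻¹ ^ d ≤ Real.exp d := by
    rw [← Real.exp_one_pow]
    refine pow_le_pow_left₀ (by positivity) ?_ d
    rw [← Real.sqrt_inv]
    have : √((2 * (1 / 4))⁻¹) ≤ 2 := by
      rw [Real.sqrt_le_left (by norm_num)]; norm_num
    linarith [Real.exp_one_gt_d9]
  have hexp : Real.exp d = Real.exp (t / 4) * δ := by
    rw [ht, mul_div_cancel_left₀ _ (by norm_num), Real.exp_add, Real.exp_log (by simpa using hδ.1)]
    field_simp [hδ.1.ne']
  have hc : stdGaussian (Vec d) {u | ‖u‖ ^ 2 ≤ t}ᶜ ≤ ENNReal.ofReal δ := by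
    have := hmarkov.trans (ENNReal.ofReal_le_ofReal (hbound.trans hexp.le))
    rw [ENNReal.ofReal_mul (by positivity)] at this
    exact (ENNReal.mul_le_mul_iff_right (by simp [Real.exp_pos]) ENNReal.ofReal_ne_top).1 this
  have h1 := prob_add_prob_compl (μ := stdGaussian (Vec d)) ms
  rw [ENNReal.ofReal_sub _ hδ.1.le, ENNReal.ofReal_one, tsub_le_iff_right, ← h1]
  gcongr

/-- Chernoff bound with 𝔼 exp(-4‖Z‖²) = 3^(-d). As e^(1/4) ≤ 3/2, the event ‖Z‖² ≤ d/16 has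
probability at most 1/2, which is below 1 - δ. -/
lemma dim_le_chiSquare_quantile (hd : 1 ≤ d) {δ : ℝ} (hδ : δ < 1 / 2) :
    ENNReal.ofReal (d / 16) ≤
      quantile (stdGaussian (Vec d)) (fun z => ‖z‖ ^ 2) (1 - δ) := by
  refine le_quantile ?_
  set t : ℝ := d / 16 with ht
  have hI := lintegral_exp_sq_stdGaussian (d := d) (b := 9 / 2) (by norm_num)
  have hmarkov : ENNReal.ofReal (Real.exp (-4 * t)) * stdGaussian (Vec d) {u | ‖u‖ ^ 2 ≤ t} ≤
      ENNReal.ofReal ((√(2 * (9 / 2)))⁻¹ ^ d) := by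
    rw [← hI]
    refine le_trans ?_ (mul_meas_ge_le_lintegral₀ (by fun_prop)
      (ENNReal.ofReal (Real.exp (-4 * t))))
    gcongr with u
    intro hu
    have hu' : ‖u‖ ^ 2 ≤ t := hu
    refine ENNReal.ofReal_le_ofReal (Real.exp_le_exp.2 ?_)
    linarith
  have h3 : √(2 * (9 / 2)) = 3 := by
    rw [show (2 * (9 / 2) : ℝ) = 3 ^ 2 by norm_num]; exact Real.sqrt_sq (by norm_num)
  have hexp : Real.exp (1 / 4) ≤ 3 / 2 := by
    have h4 : Real.exp (1 / 4) ^ 4 = Real.exp 1 := by rw [← Real.exp_nat_mul]; norm_num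
    refine le_of_pow_le_pow_left₀ (n := 4) (by norm_num) (by norm_num) ?_
    rw [h4]
    linarith [Real.exp_one_lt_d9]
  have hbound : (√(2 * (9 / 2)))⁻¹ ^ d ≤ Real.exp (-4 * t) * (1 / 2) := by
    rw [h3]
    have e1 : Real.exp (-4 * t) = (Real.exp (1 / 4))⁻¹ ^ d := by
      rw [← Real.exp_neg, ← Real.exp_nat_mul, ht]; ring_nf
    have e2 : (3 : ℝ)⁻¹ ≤ (Real.exp (1 / 4))⁻¹ * (1 / 2) := by
      rw [inv_eq_one_div, inv_mul_eq_div, div_le_div_iff₀ (by norm_num) (Real.exp_pos _)]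
      linarith
    calc (3 : ℝ)⁻¹ ^ d ≤ ((Real.exp (1 / 4))⁻¹ * (1 / 2)) ^ d := by gcongr
      _ = (Real.exp (1 / 4))⁻¹ ^ d * (1 / 2) ^ d := mul_pow _ _ _
      _ ≤ (Real.exp (1 / 4))⁻¹ ^ d * (1 / 2) := by
          gcongr
          exact pow_le_of_le_one (by norm_num) (by norm_num) (by omega)
      _ = _ := by rw [e1]
  have hc : stdGaussian (Vec d) {u | ‖u‖ ^ 2 ≤ t} ≤ ENNReal.ofReal (1 / 2) := by
    have := hmarkov.trans (ENNReal.ofReal_le_ofReal hbound)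
    rw [ENNReal.ofReal_mul (by positivity)] at this
    exact (ENNReal.mul_le_mul_iff_right (by simp [Real.exp_pos]) ENNReal.ofReal_ne_top).1 this
  refine hc.trans_lt ((ENNReal.ofReal_lt_ofReal_iff (by linarith)).2 (by linarith))

/-- One coordinate is enough: it falls in (√t, √t + 1] with probability at least e^(-t-3). For t =
log(1/δ)/2 one has δ = e^(-2t), which is smaller once t > 3; this is where 7 comes from. -/
lemma log_le_chiSquare_quantile (hd : 1 ≤ d) {δ : ℝ} (hδ : 0 < δ)
    (hL : 7 ≤ Real.log (1 / δ)) :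
    ENNReal.ofReal (Real.log (1 / δ) / 2) ≤
      quantile (stdGaussian (Vec d)) (fun z => ‖z‖ ^ 2) (1 - δ) := by
  refine le_quantile ?_
  set t : ℝ := Real.log (1 / δ) / 2 with ht
  have ht0 : 0 ≤ t := by linarith
  set i : Fin d := ⟨0, hd⟩
  have hmap : MeasurePreserving (fun u : Vec d => u i) (stdGaussian (Vec d)) (gaussianReal 0 1) := by
    have := measurePreserving_eval_multivariateGaussian (μ := (0 : EuclideanSpace ℝ (Fin d)))
      (S := (1 : Matrix (Fin d) (Fin d) ℝ)) Matrix.PosSemidef.one (i := i)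
    simpa [multivariateGaussian_zero_one] using this
  have hδe : δ = Real.exp (-(2 * t)) := by
    rw [ht, mul_div_cancel₀ _ (two_ne_zero), one_div, Real.log_inv, neg_neg, Real.exp_log hδ]
  have hle : ENNReal.ofReal (Real.exp (-t - 3)) ≤ gaussianReal 0 1 (Set.Ioc (√t) (√t + 1)) := by
    rw [gaussianReal_apply_eq_integral 0 one_ne_zero]
    refine ENNReal.ofReal_le_ofReal ?_
    have hc : ∀ x ∈ Set.Ioc (√t) (√t + 1), Real.exp (-t - 3) ≤ gaussianPDFReal 0 1 x := by
      intro x hx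
      have hs := Real.sq_sqrt ht0
      have hs0 := Real.sqrt_nonneg t
      have hx2 : x ^ 2 / 2 ≤ t + 1 := by nlinarith [hx.1, hx.2, sq_nonneg (√t - 1)]
      have hpi : √(2 * Real.pi) ≤ Real.exp 2 := by
        have h1 : √(2 * Real.pi) ≤ 3 := by
          rw [Real.sqrt_le_left (by norm_num)]; linarith [Real.pi_lt_four]
        linarith [Real.add_one_le_exp 2]
      rw [gaussianPDFReal_def]
      simp only [NNReal.coe_one, mul_one, sub_zero]
      calc Real.exp (-t - 3) = (Real.exp 2)⁻¹ * Real.exp (-t - 1) := by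
            rw [← Real.exp_neg, ← Real.exp_add]; ring_nf
        _ ≤ _ := by
            gcongr
            linarith
    have := setIntegral_mono_on (μ := volume) (s := Set.Ioc (√t) (√t + 1))
      (integrable_const (Real.exp (-t - 3))) (integrable_gaussianPDFReal 0 1).integrableOn
      measurableSet_Ioc hc
    simpa using this
  have hlt : ENNReal.ofReal δ < gaussianReal 0 1 (Set.Ioc (√t) (√t + 1)) := by
    refine lt_of_lt_of_le ?_ hle
    rw [hδe, ENNReal.ofReal_lt_ofReal_iff (Real.exp_pos _), Real.exp_lt_exp]
    linarith
  rw [← hmap.measure_preimage measurableSet_Ioc.nullMeasurableSet] at hlt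
  have ms : MeasurableSet {u : Vec d | ‖u‖ ^ 2 ≤ t} := measurableSet_le (by fun_prop) (by fun_prop)
  have hlt2 : ENNReal.ofReal δ < stdGaussian (Vec d) {u | ‖u‖ ^ 2 ≤ t}ᶜ := by
    refine hlt.trans_le (measure_mono fun u hu => ?_)
    have h1 : √t < u i := hu.1
    have h2 : t < (u i) ^ 2 := by
      rw [← Real.sq_sqrt ht0]
      exact pow_lt_pow_left₀ h1 (Real.sqrt_nonneg t) two_ne_zero
    have h3 : (u i) ^ 2 ≤ ‖u‖ ^ 2 := by
      rw [EuclideanSpace.real_norm_sq_eq]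
      exact Finset.single_le_sum (f := fun j => (u j) ^ 2) (fun j _ => sq_nonneg _)
        (Finset.mem_univ i)
    exact not_le.2 (h2.trans_le h3)
  have hadd := prob_add_prob_compl (μ := stdGaussian (Vec d)) ms
  rw [ENNReal.ofReal_sub _ hδ.le, ENNReal.ofReal_one, ← hadd]
  refine lt_tsub_iff_right.2 ?_
  exact ENNReal.add_lt_add_left (measure_ne_top _ _) hlt2

lemma chiSquare_lower_tail (hd : 1 ≤ d) {δ : ℝ} (hδ : 0 < δ) (hδ2 : δ < 1 / 2) :
    ENNReal.ofReal (1 / 128 * (d + Real.log (1 / δ))) ≤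
      quantile (stdGaussian (Vec d)) (fun z => ‖z‖ ^ 2) (1 - δ) := by
  have h1 := dim_le_chiSquare_quantile hd hδ2
  have hd' : (1 : ℝ) ≤ d := by exact_mod_cast hd
  -- If the logarithm is below 7, then d + log(1/δ) ≤ 8d, and d/16 = 8d/128 fixes the constant.
  rcases le_or_gt 7 (Real.log (1 / δ)) with hL | hL
  · have h2 := log_le_chiSquare_quantile hd hδ hL
    rcases le_total (d : ℝ) (Real.log (1 / δ)) with h | h
    · exact (ENNReal.ofReal_le_ofReal (by linarith)).trans h2
    · exact (ENNReal.ofReal_le_ofReal (by linarith)).trans h1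
  · exact (ENNReal.ofReal_le_ofReal (by linarith)).trans h1

end ChiSquareBounds

/-! ### The sample as a function of design and standardized noise. -/

section Sampling

variable {d n : ℕ}

/-- The design operator `v ↦ (⟪x_i, v⟫)_i`. -/
noncomputable def design (x : Fin n → Vec d) : Vec d →L[ℝ] EuclideanSpace ℝ (Fin n) :=
  (EuclideanSpace.equiv (Fin n) ℝ).symm.toContinuousLinearMap ∘L
    ContinuousLinearMap.pi fun i => innerSL ℝ (x i)

@[simp] lemma design_apply (x : Fin n → Vec d) (v : Vec d) (i : Fin n) :
    design x v i = inner ℝ (x i) v := rfl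

lemma norm_design_sq (x : Fin n → Vec d) (v : Vec d) :
    ‖design x v‖ ^ 2 = ∑ i, (inner ℝ (x i) v) ^ 2 := by
  rw [EuclideanSpace.real_norm_sq_eq]
  rfl

/-- The sample produced by the parameter `w`, the inputs `x` and the standardized noise `ε`. -/
noncomputable def sample (σ : ℝ≥0) (w : Vec d)
    (p : (Fin n → Vec d) × EuclideanSpace ℝ (Fin n)) : Fin n → Vec d × ℝ :=
  fun i => (p.1 i, inner ℝ w (p.1 i) + σ * p.2 i)

lemma measurable_sample (σ : ℝ≥0) :
    Measurable fun q : Vec d × ((Fin n → Vec d) × EuclideanSpace ℝ (Fin n)) =>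
      sample σ q.1 q.2 := by
  unfold sample
  refine measurable_pi_lambda _ fun i => ?_
  fun_prop

variable {PX : Measure (Vec d)} [IsProbabilityMeasure PX]

/-- Separating inputs from noise allows conditioning on the design by Fubini. -/
lemma measurePreserving_sample (σ : ℝ≥0) (w : Vec d) :
    MeasurePreserving (sample (n := n) σ w)
      ((Measure.pi fun _ : Fin n => PX).prod (stdGaussian (EuclideanSpace ℝ (Fin n))))
      (Measure.pi fun _ : Fin n =>
        (inputNoise PX σ).map fun z => (z.1, inner ℝ w z.1 + z.2)) := by
  have h1 : MeasurePreserving (WithLp.ofLp : EuclideanSpace ℝ (Fin n) → (Fin n → ℝ))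
      (stdGaussian (EuclideanSpace ℝ (Fin n))) (Measure.pi fun _ => gaussianReal 0 1) := by
    refine ⟨by fun_prop, ?_⟩
    rw [← map_pi_eq_stdGaussian, Measure.map_map (by fun_prop) (by fun_prop)]
    exact Measure.map_id
  have h2 := ((MeasurePreserving.id (Measure.pi fun _ : Fin n => PX)).prod h1)
  have h3 := (measurePreserving_arrowProdEquivProdArrow (Vec d) ℝ (Fin n)
    (fun _ => PX) (fun _ => gaussianReal 0 1)).symm
  have h4 : MeasurePreserving (fun z : Vec d × ℝ => (z.1, inner ℝ w z.1 + σ * z.2))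
      (PX.prod (gaussianReal 0 1))
      ((inputNoise PX σ).map fun z => (z.1, inner ℝ w z.1 + z.2)) := by
    have h5 : MeasurePreserving (fun t : ℝ => (σ : ℝ) * t) (gaussianReal 0 1)
        (gaussianReal 0 (σ ^ 2)) := by
      refine ⟨by fun_prop, ?_⟩
      rw [gaussianReal_map_const_mul]
      congr 1
      · simp
      · ext; simp
    have h6 := (MeasurePreserving.id PX).prod h5
    have h7 : MeasurePreserving (fun z : Vec d × ℝ => (z.1, inner ℝ w z.1 + z.2))
        (inputNoise PX σ) ((inputNoise PX σ).map fun z => (z.1, inner ℝ w z.1 + z.2)) :=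
      ⟨by fun_prop, rfl⟩
    exact h7.comp h6
  have : IsProbabilityMeasure ((inputNoise PX σ).map fun z => (z.1, inner ℝ w z.1 + z.2)) :=
    Measure.isProbabilityMeasure_map (by fun_prop)
  have h8 := measurePreserving_pi (fun _ : Fin n => PX.prod (gaussianReal 0 1))
    (fun _ : Fin n => (inputNoise PX σ).map fun z => (z.1, inner ℝ w z.1 + z.2))
    (fun _ => h4)
  exact h8.comp (h3.comp h2)

end Sampling

/-! ### From worst case to Bayes risk. -/

section LowerBound

variable {d n : ℕ} {PX : Measure (Vec d)} [IsProbabilityMeasure PX]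

/-- If a procedure succeeds with probability at least `p` for every parameter, then so does the
posterior mean under the prior `N(0, σ² I)`, up to the probability of an atypical design. -/
lemma le_add_of_forall_success {σ : ℝ≥0} (hσ : 0 < σ)
    {what : (Fin n → Vec d × ℝ) → Vec d} (hwhat : Measurable what)
    {g : Vec d → ℝ} (hg : Measurable g) {t s : ℝ} {p : ℝ≥0∞}
    {bad : Set (Fin n → Vec d)} (hbad : MeasurableSet bad)
    (hgood : ∀ x ∉ bad, ∀ v, g v ≤ t → ‖v‖ ^ 2 + ‖design x v‖ ^ 2 ≤ (σ : ℝ) ^ 2 * s)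
    (hp : ∀ w, p ≤ ((Measure.pi fun _ : Fin n => PX).prod
      (stdGaussian (EuclideanSpace ℝ (Fin n)))) {q | g (what (sample σ w q) - w) ≤ t}) :
    p ≤ (Measure.pi fun _ : Fin n => PX) bad + stdGaussian (Vec d) {u | ‖u‖ ^ 2 ≤ s} := by
  set μ := Measure.pi fun _ : Fin n => PX
  set γ := stdGaussian (EuclideanSpace ℝ (Fin n))
  have hσ' : (0 : ℝ) < σ := hσ
  let T : Set ((Vec d × (Fin n → Vec d)) × EuclideanSpace ℝ (Fin n)) :=
    {q | g (what (sample σ ((σ : ℝ) • q.1.1) (q.1.2, q.2)) - (σ : ℝ) • q.1.1) ≤ t}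
  have hT : MeasurableSet T := by
    refine measurableSet_le (hg.comp (Measurable.sub (hwhat.comp ?_) (by fun_prop)))
      measurable_const
    exact (measurable_sample σ).comp
      (by fun_prop : Measurable fun q : (Vec d × (Fin n → Vec d)) × EuclideanSpace ℝ (Fin n) =>
        ((σ : ℝ) • q.1.1, (q.1.2, q.2)))
  have hF : Measurable fun z : Vec d × (Fin n → Vec d) => γ (Prod.mk z ⁻¹' T) :=
    measurable_measure_prodMk_left hT
  have h1 : p ≤ ∫⁻ u, ∫⁻ x, γ (Prod.mk (u, x) ⁻¹' T) ∂μ ∂(stdGaussian (Vec d)) := by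
    calc p = ∫⁻ _, p ∂(stdGaussian (Vec d)) := by simp
      _ ≤ _ := lintegral_mono fun u => by
        refine (hp ((σ : ℝ) • u)).trans (le_of_eq ?_)
        rw [Measure.prod_apply]
        · rfl
        · exact (by fun_prop : Measurable fun q : (Fin n → Vec d) × EuclideanSpace ℝ (Fin n) =>
            ((u, q.1), q.2)) hT
  have hx : ∀ x, ∫⁻ u, γ (Prod.mk (u, x) ⁻¹' T) ∂(stdGaussian (Vec d)) =
      ((stdGaussian (Vec d)).prod γ) {r | ((r.1, x), r.2) ∈ T} := by
    intro x
    rw [Measure.prod_apply]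
    · rfl
    · exact (by fun_prop : Measurable fun r : Vec d × EuclideanSpace ℝ (Fin n) =>
        ((r.1, x), r.2)) hT
  -- The prior average is moved inside, so that the fixed-design bound applies for each x.
  rw [lintegral_lintegral_swap hF.aemeasurable] at h1
  refine h1.trans ?_
  have hgoodx : ∀ x ∉ bad, ((stdGaussian (Vec d)).prod γ) {r | ((r.1, x), r.2) ∈ T} ≤
      stdGaussian (Vec d) {u | ‖u‖ ^ 2 ≤ s} := by
    intro x hxb
    -- In units of σ, the procedure at fixed inputs estimates u from the observation Au + ε.
    let f : EuclideanSpace ℝ (Fin n) → Vec d := fun y =>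
      (σ : ℝ)⁻¹ • what fun i => (x i, (σ : ℝ) * y i)
    have hf : Measurable f := by
      refine Measurable.const_smul (hwhat.comp (measurable_pi_lambda _ fun i => ?_)) ((σ : ℝ)⁻¹)
      fun_prop
    refine le_trans (measure_mono ?_) (prior_mass_le (design x) f hf s)
    rintro ⟨u, ε⟩ hr
    have hs : sample σ ((σ : ℝ) • u) (x, ε) = fun i => (x i, (σ : ℝ) * (design x u + ε) i) := by
      funext i
      simp only [sample, inner_smul_left, conj_trivial, PiLp.add_apply, design_apply,
        real_inner_comm u]
      rw [mul_add]
    have hv : what (sample σ ((σ : ℝ) • u) (x, ε)) - (σ : ℝ) • u =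
        (σ : ℝ) • (f (design x u + ε) - u) := by
      rw [hs, smul_sub, smul_inv_smul₀ hσ'.ne']
    have h2 := hgood x hxb _ (show g (what (sample σ ((σ : ℝ) • u) (x, ε)) - (σ : ℝ) • u) ≤ t
      from hr)
    rw [hv, map_smul, norm_smul, norm_smul, mul_pow, mul_pow, Real.norm_eq_abs, sq_abs,
      ← mul_add] at h2
    exact le_of_mul_le_mul_left h2 (by positivity)
  calc ∫⁻ x, ∫⁻ u, γ (Prod.mk (u, x) ⁻¹' T) ∂(stdGaussian (Vec d)) ∂μ
      ≤ ∫⁻ x, (bad.indicator 1 x + stdGaussian (Vec d) {u | ‖u‖ ^ 2 ≤ s}) ∂μ := by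
        refine lintegral_mono fun x => ?_
        rw [hx]
        by_cases hxb : x ∈ bad
        · rw [Set.indicator_of_mem hxb]
          exact prob_le_one.trans le_self_add
        · exact (hgoodx x hxb).trans le_add_self
    _ = _ := by
        rw [lintegral_add_right _ measurable_const, lintegral_indicator_one hbad, lintegral_const,
          measure_univ, mul_one]

end LowerBound

/-! ### The least squares estimator. -/

section LeastSquares

variable {d n : ℕ}

/-- Inversion is continuous on the open set of units and has the default value 0 elsewhere. This
makes least squares an admissible procedure. -/
lemma measurable_ringInverse {E : Type*} [NormedAddCommGroup E] [NormedSpace ℝ E]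
    [CompleteSpace E] : Measurable (Ring.inverse : (E →L[ℝ] E) → (E →L[ℝ] E)) := by
  classical
  have h : (Ring.inverse : (E →L[ℝ] E) → (E →L[ℝ] E)) =
      {M | IsUnit M}.piecewise Ring.inverse (fun _ => 0) := by
    funext M
    by_cases hM : IsUnit M
    · simp [Set.piecewise, hM]
    · simp [Set.piecewise, hM, Ring.inverse_non_unit]
  rw [h]
  refine ContinuousOn.measurable_piecewise ?_ continuousOn_const Units.isOpen.measurableSet
  rintro M ⟨u, rfl⟩
  exact (NormedRing.inverse_continuousAt u).continuousWithinAt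

/-- The ordinary least squares estimator (with a junk value if the Gram operator is singular). -/
noncomputable def leastSquares (D : Fin n → Vec d × ℝ) : Vec d :=
  Ring.inverse (∑ i, InnerProductSpace.rankOne ℝ (D i).1 (D i).1) (∑ i, (D i).2 • (D i).1)

lemma measurable_leastSquares : Measurable (leastSquares : (Fin n → Vec d × ℝ) → Vec d) := by
  have h1 : Measurable fun D : Fin n → Vec d × ℝ =>
      ∑ i, InnerProductSpace.rankOne ℝ (D i).1 (D i).1 :=
    Finset.measurable_fun_sum _ fun i _ => continuous_rankOne_self.measurable.comp (by fun_prop)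
  have h2 : Measurable fun D : Fin n → Vec d × ℝ => ∑ i, (D i).2 • (D i).1 := by fun_prop
  have h3 : Continuous fun q : (Vec d →L[ℝ] Vec d) × Vec d => q.1 q.2 := by fun_prop
  exact h3.measurable.comp ((measurable_ringInverse.comp h1).prodMk h2)

/-- For a fixed nonsingular design, the in-sample error of least squares has a scaled `χ²`
distribution. -/
lemma leastSquares_inSample_error (σ : ℝ≥0) (hσ : 0 < σ) (w : Vec d) (x : Fin n → Vec d)
    (hx : ∀ v, v ≠ 0 → 0 < ‖design x v‖ ^ 2) (s : ℝ) :
    stdGaussian (EuclideanSpace ℝ (Fin n))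
      {ε | ‖design x (leastSquares (sample σ w (x, ε)) - w)‖ ^ 2 ≤ (σ : ℝ) ^ 2 * s} =
    stdGaussian (Vec d) {u | ‖u‖ ^ 2 ≤ s} := by
  have hσ' : (0 : ℝ) < σ := hσ
  set A := design x
  let M : Vec d →L[ℝ] Vec d := ∑ i, InnerProductSpace.rankOne ℝ (x i) (x i)
  have hA : ∀ y v, inner ℝ y (A v) = ∑ i, y i * inner ℝ (x i) v := by
    intro y v
    rw [PiLp.inner_apply]
    exact Finset.sum_congr rfl fun i _ => mul_comm _ _
  have hM : ∀ u v, inner ℝ (M u) v = inner ℝ (A u) (A v) := by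
    intro u v
    simp only [hA, M, _root_.sum_apply, InnerProductSpace.rankOne_apply, sum_inner,
      inner_smul_left, conj_trivial]
    rfl
  have hMpos : ∀ v, v ≠ 0 → 0 < inner ℝ (M v) v := fun v hv => by
    rw [hM, real_inner_self_eq_norm_sq]; exact hx v hv
  obtain ⟨B, hB⟩ := exists_whitening M
    (fun u v => by
      linarith [hM u v, hM v u, real_inner_comm (A u) (A v), real_inner_comm u (M v)]) hMpos
  have hunit : IsUnit M := by
    rw [ContinuousLinearMap.isUnit_iff_bijective]
    have hinj : Function.Injective M := by
      rw [injective_iff_map_eq_zero]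
      intro v hv
      by_contra h
      have := hMpos v h
      rw [hv, inner_zero_left] at this
      exact lt_irrefl _ this
    exact ⟨hinj, (LinearMap.injective_iff_surjective (f := (M : Vec d →ₗ[ℝ] Vec d))).1 hinj⟩
  -- Whitening the Gram operator makes `AB` an isometry, so its adjoint sends the noise to a
  -- standard Gaussian vector; the normal equations identify the whitened error with σ(AB)†ε.
  let AB : Vec d →L[ℝ] EuclideanSpace ℝ (Fin n) := A ∘L (B : Vec d →L[ℝ] Vec d)
  have hABn : ∀ t, ‖AB t‖ = ‖t‖ := by
    intro t
    have := hB t t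
    rw [hM, real_inner_self_eq_norm_sq, real_inner_self_eq_norm_sq] at this
    exact (sq_eq_sq₀ (norm_nonneg _) (norm_nonneg _)).1 this
  have hmap := stdGaussian_map_of_norm_adjoint (ContinuousLinearMap.adjoint AB)
    (by simpa using hABn)
  have key : ∀ ε, ‖A (leastSquares (sample σ w (x, ε)) - w)‖ ^ 2 =
      (σ : ℝ) ^ 2 * ‖ContinuousLinearMap.adjoint AB ε‖ ^ 2 := by
    intro ε
    set Δ := leastSquares (sample σ w (x, ε)) - w
    have hMΔ : ∀ v, inner ℝ (M Δ) v = σ * inner ℝ ε (A v) := by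
      intro v
      have h1 : M (leastSquares (sample σ w (x, ε))) =
          ∑ i, (inner ℝ w (x i) + σ * ε i) • x i := by
        have := congrArg (fun T : Vec d →L[ℝ] Vec d =>
          T (∑ i, (inner ℝ w (x i) + σ * ε i) • x i)) (Ring.mul_inverse_cancel M hunit)
        exact this
      have h2 : M w = ∑ i, inner ℝ w (x i) • x i := by
        simp only [M, _root_.sum_apply, InnerProductSpace.rankOne_apply, real_inner_comm w]
      rw [map_sub, h1, h2, ← Finset.sum_sub_distrib]
      simp only [← sub_smul, add_sub_cancel_left, sum_inner, inner_smul_left, conj_trivial,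
        hA, Finset.mul_sum, mul_assoc]
    have hsol : B.symm Δ = (σ : ℝ) • ContinuousLinearMap.adjoint AB ε := by
      refine ext_inner_right ℝ fun v => ?_
      rw [← hB, ContinuousLinearEquiv.apply_symm_apply, hMΔ, inner_smul_left,
        ContinuousLinearMap.adjoint_inner_left]
      rfl
    have h3 := hB (B.symm Δ) (B.symm Δ)
    rw [ContinuousLinearEquiv.apply_symm_apply, hM, real_inner_self_eq_norm_sq,
      real_inner_self_eq_norm_sq, hsol, norm_smul, mul_pow, Real.norm_eq_abs, sq_abs] at h3
    exact h3
  simp only [key]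
  rw [← hmap, Measure.map_apply (by fun_prop) (measurableSet_le (by fun_prop) (by fun_prop))]
  congr 1
  ext ε
  exact ⟨fun h => le_of_mul_le_mul_left h (by positivity : (0 : ℝ) < (σ : ℝ) ^ 2),
    fun h => mul_le_mul_of_nonneg_left h (by positivity : (0 : ℝ) ≤ (σ : ℝ) ^ 2)⟩

variable {PX : Measure (Vec d)} [IsProbabilityMeasure PX]

/-- Least squares succeeds with the `χ²` probability, up to the probability of an atypical
design. -/
lemma leastSquares_success {σ : ℝ≥0} (hσ : 0 < σ) {g : Vec d → ℝ} (hg : Measurable g) {t s : ℝ}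
    {bad : Set (Fin n → Vec d)} (hbad : MeasurableSet bad)
    (hpos : ∀ x ∉ bad, ∀ v, v ≠ 0 → 0 < ‖design x v‖ ^ 2)
    (hgood : ∀ x ∉ bad, ∀ v, ‖design x v‖ ^ 2 ≤ (σ : ℝ) ^ 2 * s → g v ≤ t) (w : Vec d) :
    stdGaussian (Vec d) {u | ‖u‖ ^ 2 ≤ s} ≤
      ((Measure.pi fun _ : Fin n => PX).prod (stdGaussian (EuclideanSpace ℝ (Fin n))))
        {q | g (leastSquares (sample σ w q) - w) ≤ t} + (Measure.pi fun _ : Fin n => PX) bad := by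
  set μ := Measure.pi fun _ : Fin n => PX
  have hT : MeasurableSet {q : (Fin n → Vec d) × EuclideanSpace ℝ (Fin n) |
      g (leastSquares (sample σ w q) - w) ≤ t} := by
    refine measurableSet_le (hg.comp (Measurable.sub_const (measurable_leastSquares.comp ?_) w))
      measurable_const
    exact (measurable_sample σ).comp measurable_prodMk_left
  rw [Measure.prod_apply hT, ← lintegral_indicator_one hbad,
    ← lintegral_add_right _ (measurable_one.indicator hbad)]
  calc stdGaussian (Vec d) {u | ‖u‖ ^ 2 ≤ s}
      = ∫⁻ _, stdGaussian (Vec d) {u | ‖u‖ ^ 2 ≤ s} ∂μ := by simp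
    _ ≤ _ := lintegral_mono fun x => ?_
  by_cases hx : x ∈ bad
  · rw [Set.indicator_of_mem hx]
    exact prob_le_one.trans le_add_self
  · rw [← leastSquares_inSample_error σ hσ w x (hpos x hx) s]
    exact (measure_mono fun ε hε => hgood x hx _ hε).trans le_self_add

end LeastSquares

/-! ### Letting the sample size grow. -/

section Asymptotics

variable {d : ℕ} {PX : Measure (Vec d)} [IsProbabilityMeasure PX]

/-- If `σ² α s < r`, then least squares eventually has excess loss at most `r / n` with probability
at least any `p` below the `χ²` probability of `[0, s]`, uniformly in the parameter. -/
lemma eventually_leastSquares_success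
    (hint : Integrable (fun x : Vec d => InnerProductSpace.rankOne ℝ x x) PX)
    (hpos : ∀ v, v ≠ 0 → 0 < inner ℝ (secondMoment PX v) v)
    {σ : ℝ≥0} (hσ : 0 < σ) {g : Vec d → ℝ} (hg : Measurable g) {α : ℝ} (hα : 0 < α)
    (hupper : ∀ ε > 0, ∃ s > 0, ∀ v, inner ℝ (secondMoment PX v) v ≤ s →
      g v ≤ α * (1 + ε) * inner ℝ (secondMoment PX v) v)
    {s r : ℝ} (hs : 0 < s) (hr : (σ : ℝ) ^ 2 * α * s < r)
    {p : ℝ≥0∞} (hp : p < stdGaussian (Vec d) {u | ‖u‖ ^ 2 ≤ s}) :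
    ∀ᶠ n : ℕ in atTop, ∀ w, p ≤ ((Measure.pi fun _ : Fin n => PX).prod
      (stdGaussian (EuclideanSpace ℝ (Fin n))))
        {q | g (leastSquares (sample σ w q) - w) ≤ r / n} := by
  have hσ' : (0 : ℝ) < σ := hσ
  obtain ⟨c, hc, hcoer⟩ := exists_coercive _ hpos
  set k := (σ : ℝ) ^ 2 * α * s with hk
  have hk0 : 0 < k := by positivity
  -- The solution of (1 + ε)k = r(1 - ε): the factor 1 + ε is lost in the expansion of `g`, and 1 -
  -- ε in the Gram operator.
  set ε := (r - k) / (r + k) with hε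
  have hε0 : 0 < ε := div_pos (by linarith) (by linarith)
  have hε1 : ε < 1 := by rw [hε, div_lt_one (by linarith)]; linarith
  have hεk : (1 + ε) * k = r * (1 - ε) := by
    have : r + k ≠ 0 := by linarith
    rw [hε]; field_simp; ring
  have h1e : 0 < 1 - ε := by linarith
  obtain ⟨s₀, hs₀, hup⟩ := hupper ε hε0
  have hbad := tendsto_measure_sampleMoment hint (mul_pos hε0 hc)
  have hsmall : Tendsto (fun n : ℕ => (σ : ℝ) ^ 2 * s / (1 - ε) / n) atTop (𝓝 0) :=
    tendsto_const_div_atTop_nhds_zero_nat _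
  have hgap : 0 < stdGaussian (Vec d) {u | ‖u‖ ^ 2 ≤ s} - p := tsub_pos_of_lt hp
  filter_upwards [hbad.eventually_le_const hgap, hsmall.eventually_le_const hs₀,
    eventually_gt_atTop 0] with n hn1 hn2 hn w
  have hn' : (0 : ℝ) < n := by exact_mod_cast hn
  set bad := {x : Fin n → Vec d | ε * c ≤
    ‖(n : ℝ)⁻¹ • ∑ i, InnerProductSpace.rankOne ℝ (x i) (x i) - secondMoment PX‖}
  have hlow : ∀ x ∉ bad, ∀ v, n * (1 - ε) * inner ℝ (secondMoment PX v) v ≤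
      ‖design x v‖ ^ 2 := by
    intro x hx v
    have := (abs_le.1 (sampleMoment_bounds hε0 hcoer hn (not_le.1 hx) v)).1
    rw [norm_design_sq]
    linarith
  have key := leastSquares_success (PX := PX) hσ hg (t := r / n) (s := s)
    (measurableSet_sampleMoment (secondMoment PX) (ε * c))
    (fun x hx v hv => lt_of_lt_of_le (by have := hpos v hv; positivity) (hlow x hx v))
    (fun x hx v hv => by
      have h1 : inner ℝ (secondMoment PX v) v ≤ (σ : ℝ) ^ 2 * s / (1 - ε) / n := by
        rw [div_div, le_div_iff₀ (by positivity)]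
        linarith [hlow x hx v]
      refine (hup v (h1.trans hn2)).trans ?_
      calc α * (1 + ε) * inner ℝ (secondMoment PX v) v
          ≤ α * (1 + ε) * ((σ : ℝ) ^ 2 * s / (1 - ε) / n) := by gcongr
        _ = (1 + ε) * k / (1 - ε) / n := by rw [hk]; ring
        _ = r / n := by rw [hεk, mul_div_cancel_right₀ _ h1e.ne']) w
  have hsum := (add_le_add_right hn1 p).trans_eq (add_tsub_cancel_of_le hp.le)
  have hfin : (Measure.pi fun _ : Fin n => PX) bad ≠ ∞ := measure_ne_top _ _
  exact (ENNReal.add_le_add_iff_right hfin).1 (hsum.trans key)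

/-- If `r < σ² α s`, then eventually no procedure has excess loss at most `r / n` with probability
at least `p` for every parameter, for any `p` above the `χ²` probability of `[0, s]`. -/
lemma eventually_not_forall_success
    (hint : Integrable (fun x : Vec d => InnerProductSpace.rankOne ℝ x x) PX)
    (hpos : ∀ v, v ≠ 0 → 0 < inner ℝ (secondMoment PX v) v)
    {σ : ℝ≥0} (hσ : 0 < σ) {g : Vec d → ℝ} (hg : Measurable g) {α : ℝ} (hα : 0 < α)
    (hlower : ∀ ε, 0 < ε → ε < 1 → ∃ t > 0, ∀ v, g v ≤ t →
      α * (1 - ε) * inner ℝ (secondMoment PX v) v ≤ g v)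
    {s r : ℝ} (hr0 : 0 < r) (hr : r < (σ : ℝ) ^ 2 * α * s)
    {p : ℝ≥0∞} (hp : stdGaussian (Vec d) {u | ‖u‖ ^ 2 ≤ s} < p) :
    ∀ᶠ n : ℕ in atTop, ∀ what : (Fin n → Vec d × ℝ) → Vec d, Measurable what →
      ¬ ∀ w, p ≤ ((Measure.pi fun _ : Fin n => PX).prod
        (stdGaussian (EuclideanSpace ℝ (Fin n)))) {q | g (what (sample σ w q) - w) ≤ r / n} := by
  obtain ⟨c, hc, hcoer⟩ := exists_coercive _ hpos
  set k := (σ : ℝ) ^ 2 * α * s with hk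
  -- The solution of (1 + 2ε)r = k(1 - ε): one ε pays for the Gram operator, one for the prior term
  -- ‖v‖², and 1 - ε for the expansion of `g`.
  set ε := (k - r) / (k + 2 * r) with hε
  have hε0 : 0 < ε := div_pos (by linarith) (by linarith)
  have hε1 : ε < 1 := by rw [hε, div_lt_one (by linarith)]; linarith
  have hεk : (1 + 2 * ε) * r = k * (1 - ε) := by
    have : k + 2 * r ≠ 0 := by linarith
    rw [hε]; field_simp; ring
  have h1e : 0 < 1 - ε := by linarith
  obtain ⟨t₀, ht₀, hlo⟩ := hlower ε hε0 hε1
  have hbad := tendsto_measure_sampleMoment hint (mul_pos hε0 hc)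
  have hsmall : Tendsto (fun n : ℕ => r / n) atTop (𝓝 0) :=
    tendsto_const_div_atTop_nhds_zero_nat _
  have hgap : 0 < p - stdGaussian (Vec d) {u | ‖u‖ ^ 2 ≤ s} := tsub_pos_of_lt hp
  filter_upwards [hbad.eventually_lt_const hgap, hsmall.eventually_le_const ht₀,
    eventually_gt_atTop 0, eventually_ge_atTop ⌈1 / (ε * c)⌉₊] with n hn1 hn2 hn hn3 what hwhat hall
  have hn' : (0 : ℝ) < n := by exact_mod_cast hn
  -- From this size on, the prior term is at most nε⟨Sv, v⟩.
  have hnc : 1 ≤ n * (ε * c) := by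
    rw [← div_le_iff₀ (by positivity)]
    exact (Nat.le_ceil _).trans (by exact_mod_cast hn3)
  have key := le_add_of_forall_success (PX := PX) hσ hwhat hg (t := r / n) (s := s)
    (measurableSet_sampleMoment (secondMoment PX) (ε * c)) (fun x hx v hv => by
      have h1 := (abs_le.1 (sampleMoment_bounds hε0 hcoer hn (not_le.1 hx) v)).2
      rw [← norm_design_sq] at h1
      have h2 := (hlo v (hv.trans hn2)).trans hv
      have h3 : ‖v‖ ^ 2 ≤ n * ε * inner ℝ (secondMoment PX v) v := by
        calc ‖v‖ ^ 2 ≤ n * (ε * c) * ‖v‖ ^ 2 := le_mul_of_one_le_left (sq_nonneg _) hnc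
          _ = n * ε * (c * ‖v‖ ^ 2) := by ring
          _ ≤ _ := by gcongr; exact hcoer v
      have h4 : inner ℝ (secondMoment PX v) v ≤ r / n / (α * (1 - ε)) := by
        rw [le_div_iff₀ (by positivity)]; linarith
      calc ‖v‖ ^ 2 + ‖design x v‖ ^ 2 ≤ n * (1 + 2 * ε) * inner ℝ (secondMoment PX v) v := by
            linarith
        _ ≤ n * (1 + 2 * ε) * (r / n / (α * (1 - ε))) := by gcongr
        _ = (1 + 2 * ε) * r / (α * (1 - ε)) := by field_simp
        _ = (σ : ℝ) ^ 2 * s := by rw [hεk, hk]; field_simp) hall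
  refine absurd key (not_le.2 ?_)
  exact lt_tsub_iff_right.1 hn1

end Asymptotics

/-! ### The limit of the minimax risk. -/

section Minimax

variable {d : ℕ} {PX : Measure (Vec d)} [IsProbabilityMeasure PX] {σ : ℝ≥0} {e : ℝ → ℝ}

/-- The local shape of the excess error of a smooth strictly convex loss. -/
lemma exists_excess_shape (hd : 1 ≤ d) (hσ : 0 < σ)
    (hne : ∀ w : Vec d, w ≠ 0 → ¬ ∀ᵐ x ∂PX, inner ℝ w x = 0)
    (hconv : StrictConvexOn ℝ Set.univ e) (heven : ∀ t, e (-t) = e t)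
    (hd1 : Differentiable ℝ e) (hd2 : Differentiable ℝ (deriv e))
    (hint : ∀ Δ : Vec d, Integrable (fun z : Vec d × ℝ => e (inner ℝ Δ z.1 + z.2))
      (inputNoise PX σ))
    (hH : HessianAtZero e PX σ) {α : ℝ}
    (hα : α = (∫ t, deriv (deriv e) t ∂(gaussianReal 0 (σ ^ 2))) / 2) :
    0 < α ∧ Integrable (fun x : Vec d => InnerProductSpace.rankOne ℝ x x) PX ∧
    (∀ v, v ≠ 0 → 0 < inner ℝ (secondMoment PX v) v) ∧
    ∃ g : Vec d → ℝ, Measurable g ∧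
      (∀ wstar w, excessError e
        ((inputNoise PX σ).map fun z => (z.1, inner ℝ wstar z.1 + z.2)) w = g (w - wstar)) ∧
      (∀ ε > 0, ∃ s > 0, ∀ v, inner ℝ (secondMoment PX v) v ≤ s →
        g v ≤ α * (1 + ε) * inner ℝ (secondMoment PX v) v) ∧
      (∀ ε, 0 < ε → ε < 1 → ∃ t > 0, ∀ v, g v ≤ t →
        α * (1 - ε) * inner ℝ (secondMoment PX v) v ≤ g v) := by
  obtain ⟨hdiff, hHint, hHd⟩ := hH
  obtain ⟨i1, i2⟩ := integrable_of_integrable_hessian hd hσ hne hconv hd1 hd2 hHint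
  have hα0 : 0 < α := by
    have := integral_deriv_deriv_pos hconv hd1 hd2 (by positivity : σ ^ 2 ≠ 0) i1
    linarith
  have hpos : ∀ v, v ≠ 0 → 0 < inner ℝ (secondMoment PX v) v := fun v hv =>
    secondMoment_pos i2 hne hv
  have hconvE := convexOn_Etilde hconv.convexOn hint
  have hmin := Etilde_zero_le heven hconv.convexOn hint
  rw [integral_hessian, show (∫ t, deriv (deriv e) t ∂(gaussianReal 0 (σ ^ 2))) = 2 * α by
    rw [hα]; ring] at hHd
  have hgrad : gradient (Etilde e PX σ) 0 = 0 := by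
    have : IsLocalMin (Etilde e PX σ) 0 := Eventually.of_forall hmin
    rw [gradient, this.fderiv_eq_zero, map_zero]
  have hexp : ∀ ε > 0, ∀ᶠ x in 𝓝 (0 : Vec d),
      |(Etilde e PX σ x - Etilde e PX σ 0) - α * inner ℝ (secondMoment PX x) x| ≤
        ε * ‖x‖ ^ 2 := by
    intro ε hε
    have h := eventually_abs_sub_quadratic_le _ _ (fun u v => by
      simp only [_root_.smul_apply, inner_smul_left, inner_smul_right, secondMoment_symm i2,
        conj_trivial]) hdiff hgrad hHd hε
    refine h.mono fun x hx => ?_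
    convert hx using 3
    simp only [_root_.smul_apply, inner_smul_left, conj_trivial]
    ring
  have hg : ConvexOn ℝ Set.univ (fun x => Etilde e PX σ x - Etilde e PX σ 0) :=
    hconvE.sub (concaveOn_const _ convex_univ)
  -- A finite convex function on a finite-dimensional space is continuous, which yields
  -- measurability of `g`.
  have hcont : Continuous (Etilde e PX σ) :=
    continuousOn_univ.1 (hconvE.continuousOn isOpen_univ)
  exact ⟨hα0, i2, hpos, fun x => Etilde e PX σ x - Etilde e PX σ 0, by fun_prop,
    fun wstar w => excessError_eq heven hd1.continuous hconv.convexOn hint wstar w,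
    fun ε hε => exists_le_quadratic hα0 hpos hexp hε,
    fun ε hε hε1 => exists_quadratic_le hα0 hpos hg (sub_self _) hexp hε hε1⟩

/-- The success probability of a procedure, in terms of standardized noise. -/
lemma measure_excessError_le {n : ℕ} {g : Vec d → ℝ} (hg : Measurable g)
    (hexc : ∀ wstar w, excessError e
        ((inputNoise PX σ).map fun z => (z.1, inner ℝ wstar z.1 + z.2)) w = g (w - wstar))
    {what : (Fin n → Vec d × ℝ) → Vec d} (hwhat : Measurable what) (w : Vec d) (t : ℝ) :
    (Measure.pi fun _ : Fin n => (inputNoise PX σ).map fun z => (z.1, inner ℝ w z.1 + z.2))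
      {D | excessError e ((inputNoise PX σ).map fun z => (z.1, inner ℝ w z.1 + z.2)) (what D) ≤ t} =
    ((Measure.pi fun _ : Fin n => PX).prod (stdGaussian (EuclideanSpace ℝ (Fin n))))
        {q | g (what (sample σ w q) - w) ≤ t} := by
  have hm : MeasurableSet {D : Fin n → Vec d × ℝ | g (what D - w) ≤ t} :=
    measurableSet_le (hg.comp (hwhat.sub_const w)) measurable_const
  simp only [hexc]
  rw [← (measurePreserving_sample σ w).measure_preimage hm.nullMeasurableSet]
  rfl

lemma tendsto_minimaxRisk (hd : 1 ≤ d) (hσ : 0 < σ) {δ : ℝ}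
    (hne : ∀ w : Vec d, w ≠ 0 → ¬ ∀ᵐ x ∂PX, inner ℝ w x = 0)
    (hconv : StrictConvexOn ℝ Set.univ e) (heven : ∀ t, e (-t) = e t)
    (hd1 : Differentiable ℝ e) (hd2 : Differentiable ℝ (deriv e))
    (hint : ∀ Δ : Vec d, Integrable (fun z : Vec d × ℝ => e (inner ℝ Δ z.1 + z.2))
      (inputNoise PX σ))
    (hH : HessianAtZero e PX σ) {α : ℝ}
    (hα : α = (∫ t, deriv (deriv e) t ∂(gaussianReal 0 (σ ^ 2))) / 2) :
    Tendsto (fun n : ℕ => (n : ℝ≥0∞) * minimaxRisk e n δ (gaussClass PX σ)) atTop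
      (𝓝 (ENNReal.ofReal ((σ : ℝ) ^ 2 * α) *
        quantile (stdGaussian (Vec d)) (fun z => ‖z‖ ^ 2) (1 - δ))) := by
  obtain ⟨hα0, i2, hpos, g, hg, hexc, hupper, hlower⟩ :=
    exists_excess_shape hd hσ hne hconv heven hd1 hd2 hint hH hα
  have hσ' : (0 : ℝ) < σ := hσ
  set k := (σ : ℝ) ^ 2 * α with hk
  have hk0 : 0 < k := by positivity
  set Q := quantile (stdGaussian (Vec d)) (fun z => ‖z‖ ^ 2) (1 - δ)
  have hscale : ∀ r : ℝ, ENNReal.ofReal r = ENNReal.ofReal k * ENNReal.ofReal (r / k) := by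
    intro r
    rw [← ENNReal.ofReal_mul hk0.le, mul_div_cancel₀ _ hk0.ne']
  have hk1 : ENNReal.ofReal k ≠ 0 := by simpa using hk0
  have hnscale : ∀ (r : ℝ) (n : ℕ), 0 < n →
      (n : ℝ≥0∞) * ENNReal.ofReal (r / n) = ENNReal.ofReal r := by
    intro r n hn
    have hn' : (0 : ℝ) < n := by exact_mod_cast hn
    rw [← ENNReal.ofReal_natCast, ← ENNReal.ofReal_mul hn'.le, mul_div_cancel₀ _ hn'.ne']
  refine tendsto_order.2 ⟨fun a ha => ?_, fun a ha => ?_⟩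
  · obtain ⟨r, hr0, har, hrQ⟩ := ENNReal.lt_iff_exists_real_btwn.1 ha
    have hr : 0 < r := ENNReal.ofReal_pos.1 (bot_le.trans_lt har)
    rw [hscale r, ENNReal.mul_lt_mul_iff_right hk1 ENNReal.ofReal_ne_top] at hrQ
    obtain ⟨s, -, hrs, hsQ⟩ := ENNReal.lt_iff_exists_real_btwn.1 hrQ
    rw [ENNReal.ofReal_lt_ofReal_iff_of_nonneg (by positivity), div_lt_iff₀' hk0] at hrs
    have hs : 0 ≤ s := by
      by_contra h
      have := mul_neg_of_pos_of_neg hk0 (not_le.1 h)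
      linarith
    have hp : stdGaussian (Vec d) {u | ‖u‖ ^ 2 ≤ s} < ENNReal.ofReal (1 - δ) := by
      by_contra h
      exact absurd (quantile_le hs (not_lt.1 h)) (not_le.2 hsQ)
    filter_upwards [eventually_not_forall_success i2 hpos hσ hg hα0 hlower hr hrs hp,
      eventually_gt_atTop 0] with n hn hn0
    refine har.trans_le ?_
    rw [← hnscale r n hn0]
    gcongr
    refine le_iInf₂ fun what hwhat => ?_
    by_contra hlt
    push Not at hlt
    refine hn what hwhat fun w => ?_
    rw [← measure_excessError_le hg hexc hwhat]
    refine le_measure_of_quantile_lt (lt_of_le_of_lt ?_ hlt)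
    exact le_iSup₂_of_le (f := fun P (_ : P ∈ gaussClass PX σ) => quantileRisk e n δ P what)
      _ ⟨w, rfl⟩ le_rfl
  · obtain ⟨r, hr0, hrQ, har⟩ := ENNReal.lt_iff_exists_real_btwn.1 ha
    rw [hscale r, ENNReal.mul_lt_mul_iff_right hk1 ENNReal.ofReal_ne_top] at hrQ
    obtain ⟨s, hs0, hsQ, hrs⟩ := ENNReal.lt_iff_exists_real_btwn.1 hrQ
    -- Two levels above the quantile are needed: at `s'` the mass is at least 1 - δ, so at `s` it is
    -- strictly larger, leaving room for the bad designs.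
    obtain ⟨s', hs', hsQ', hss⟩ := ENNReal.lt_iff_exists_real_btwn.1 hsQ
    rw [ENNReal.ofReal_lt_ofReal_iff_of_nonneg hs0, lt_div_iff₀' hk0] at hrs
    rw [ENNReal.ofReal_lt_ofReal_iff_of_nonneg hs'] at hss
    have hp : ENNReal.ofReal (1 - δ) < stdGaussian (Vec d) {u | ‖u‖ ^ 2 ≤ s} :=
      (le_measure_of_quantile_lt hsQ').trans_lt (stdGaussian_sq_lt hd hs' hss)
    filter_upwards [eventually_leastSquares_success i2 hpos hσ hg hα0 hupper
      (hs'.trans_lt hss) hrs hp, eventually_gt_atTop 0] with n hn hn0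
    refine lt_of_le_of_lt ?_ har
    rw [← hnscale r n hn0]
    gcongr
    refine iInf₂_le_of_le leastSquares measurable_leastSquares (iSup₂_le ?_)
    rintro P ⟨w, rfl⟩
    refine quantile_le (by positivity) ?_
    rw [measure_excessError_le hg hexc measurable_leastSquares]
    exact hn w

end Minimax

end QuantileRegression

theorem proposition2p2 :
    ∃ c C : ℝ, 0 < c ∧ 0 < C ∧
      ∀ (d : ℕ) (_ : 1 ≤ d) (PX : Measure (QuantileRegression.Vec d)) [IsProbabilityMeasure PX]
        (σ : ℝ≥0) (_ : 0 < σ) (e : ℝ → ℝ) (δ : ℝ) (_ : δ ∈ Set.Ioo (0 : ℝ) 1)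
        -- the support of the input distribution is not contained in any hyperplane
        (_ : ∀ w : QuantileRegression.Vec d, w ≠ 0 → ¬ ∀ᵐ x ∂PX, inner ℝ w x = 0)
        (_ : StrictConvexOn ℝ Set.univ e) (_ : ∀ t : ℝ, e (-t) = e t)
        (_ : Differentiable ℝ e) (_ : Differentiable ℝ (deriv e))
        -- finiteness of the shifted expected error everywhere
        (_ : ∀ Δ : QuantileRegression.Vec d,
          Integrable (fun z : QuantileRegression.Vec d × ℝ => e (inner ℝ Δ z.1 + z.2))
            (QuantileRegression.inputNoise PX σ))
        (_ : QuantileRegression.GradientAtZero e PX σ)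
        (_ : QuantileRegression.HessianAtZero e PX σ)
        (α : ℝ) (_ : α = (∫ t, deriv (deriv e) t ∂(gaussianReal 0 (σ ^ 2))) / 2)
        (Q : ℝ≥0∞)
        (_ : Q = QuantileRegression.quantile (stdGaussian (QuantileRegression.Vec d))
          (fun z => ‖z‖ ^ 2) (1 - δ)),
        Tendsto (fun n : ℕ => (n : ℝ≥0∞) *
            QuantileRegression.minimaxRisk e n δ (QuantileRegression.gaussClass PX σ))
          atTop (𝓝 (ENNReal.ofReal ((σ : ℝ) ^ 2 * α) * Q)) ∧
        (δ < 1 / 2 →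
          ENNReal.ofReal (c * ((σ : ℝ) ^ 2 * α * (d + Real.log (1 / δ)))) ≤
            ENNReal.ofReal ((σ : ℝ) ^ 2 * α) * Q ∧
          ENNReal.ofReal ((σ : ℝ) ^ 2 * α) * Q ≤
            ENNReal.ofReal (C * ((σ : ℝ) ^ 2 * α * (d + Real.log (1 / δ))))) := by
  refine ⟨1 / 128, 4, by norm_num, by norm_num, ?_⟩
  intro d hd PX _ σ hσ e δ hδ hne hconv heven hd1 hd2 hint _ hH α hα Q hQ
  subst hQ
  refine ⟨QuantileRegression.tendsto_minimaxRisk hd hσ hne hconv heven hd1 hd2 hint hH hα,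
    fun hδ2 => ?_⟩
  have hα0 : 0 < α := (QuantileRegression.exists_excess_shape hd hσ hne hconv heven hd1 hd2 hint
    hH hα).1
  have hk : 0 ≤ (σ : ℝ) ^ 2 * α := by positivity
  constructor
  · rw [mul_left_comm, ENNReal.ofReal_mul hk]
    gcongr
    exact QuantileRegression.chiSquare_lower_tail hd hδ.1 hδ2
  · rw [mul_left_comm 4, ENNReal.ofReal_mul hk]
    gcongr
    exact QuantileRegression.chiSquare_upper_tail hδ
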